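/- **Setting.** Let $G$ be a Lie group of dimension $n\ge 3$ with Lie algebra $\mathfrak g$ such that every left-invariant Riemannian metric on $G$ has non-positive scalar curvature. Let $I=[t_0,\infty)$ and let $J\subset\mathbb R$ be an interval with non-empty interior. Let $\gamma\in C^2(I,T^0_2\mathfrak g)$ be a family of left-invariant Riemannian metrics, $\phi\in C^2(I,J)$, $\rho\in C^1(I)$, $j\in C^1(I,T^0_1\mathfrak g)$, and $S\in C^1(I,T^0_2\mathfrak g)$ symmetric. On $M=G\times I$ put $$g=\gamma-dt\otimes dt,\qquad T=S-j\otimes dt-dt\otimes j+\rho\,dt\otimes dt .$$ Let $V,C\in C^1(J)$ and $c\in C(J)$, and assume that the coupled Einstein–scalar field–matter equations hold on $M$: $$Rc_g-\tfrac12R_g\,g=d\phi\otimes d\phi-\tfrac12|d\phi|_g^2\,g-V(\phi)\,g+C(\phi)\,T,$$ $$\Box_g\phi-V'(\phi)=-c(\phi)\operatorname{tr}_gT,\qquad \operatorname{Div}_g\big(C(\phi)T\big)=c(\phi)\,(\operatorname{tr}_gT)\,d\phi .$$ Assume moreover: * (energy conditions) $|j|_\gamma\le\rho$, $|\operatorname{tr}_\gamma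 S|\le n\rho$ and $\rho+\operatorname{tr}_\gamma S\ge0$ on $I$; * $C\ge0$, and $|c|\le C_0\,C$ on $J$ for some constant $C_0$; * $V>0$ on $J$, and (i) there is a positive lower semicontinuous function $\bar V$ on the closure of $J$ in $\mathbb R$ with $\bar V\le V$ on $J$; (ii) $V'$ is bounded on every subset of $J$ on which $V$ is bounded; (iii) $V'$ extends to a continuous function, with values in $[-\infty,\infty]$, on the closure of $J$ in $[-\infty,\infty]$; * (initial expansion) $H(t_0)>0$, where $H:=\frac1{2n}\operatorname{tr}_\gamma\dot\gamma$ is the negative of the mean curvature of the hypersurfaces of constant $t$; * $V_0:=\inf_{t\in I}V(\phi(t))=0$. **Claim.** Either $\phi(t)\to+\infty$ or $\phi(t)\to-\infty$ as $t\to\infty$. Let $\alpha:=\limsup_{x\to\infty}\frac{|V'(x)|}{V(x)}$ in the first case and $\alpha:=\limsup_{x\to-\infty}\frac{|V'(x)|}{V(x)}$ in the second (limits superior over $x\in J$). If $\alpha<\dfrac{2}{\sqrt{n(n-1)}}$, then the quantity $W:=\dfrac{n(n-1)H^2}{2V(\phi)}$ satisfies $$\limsup_{t\to\infty}W(t)\le\left(1-\frac12\sqrt{\frac{n-1}{n}}\;\alpha\right)^{-1}.$$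 -/

import Mathlib

open Set Filter Topology

noncomputable section

namespace Quintessence

/-! ### Calculus in an invariant frame

All tensor fields below are invariant under the group, hence are given by their components in a
global frame `E i` of vector fields, and these components depend on the time `t ∈ I` only.
The frame is described by
* `c i j k`, the structure functions (here constants): `[E i, E j] = ∑ k, c i j k • E k`;
* `τ i`, the number with `E i f = τ i * f'` for a function `f` of time.
A metric is given by its matrix of components `g t i j = g (E i, E j)`. -/

section Frame

variable {ι : Type*} [Fintype ι] [DecidableEq ι]

/-- The derivative `E i f` of a function `f` of `t ∈ I` along the frame field `E i`. -/
def frameDeriv (I : Set ℝ) (τ : ι → ℝ) (i : ι) (f : ℝ → ℝ) (t : ℝ) : ℝ :=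
  τ i * derivWithin f I t

/-- The trace of a covariant 2-tensor `B` with respect to a metric `g`. -/
def metricTrace (g B : Matrix ι ι ℝ) : ℝ :=
  ∑ i, ∑ j, g⁻¹ i j * B i j

/-- The connection coefficients of the Levi-Civita connection, `∇_{E i} E j = ∑ k, Γ k i j • E k`,
given by the Koszul formula
`2 g(∇_X Y, Z) = X g(Y,Z) + Y g(X,Z) - Z g(X,Y) + g([X,Y],Z) - g([X,Z],Y) - g([Y,Z],X)`. -/
def christoffel (I : Set ℝ) (c : ι → ι → ι → ℝ) (τ : ι → ℝ) (g : ℝ → Matrix ι ι ℝ)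
    (k i j : ι) (t : ℝ) : ℝ :=
  (1 / 2) * ∑ l, (g t)⁻¹ k l *
    (frameDeriv I τ i (fun s => g s j l) t + frameDeriv I τ j (fun s => g s i l) t
      - frameDeriv I τ l (fun s => g s i j) t
      + ∑ m, (c i j m * g t m l - c i l m * g t m j - c j l m * g t m i))

/-- The component along `E l` of the Riemann curvature
`R(E i, E j) E k = ∇_{E i} ∇_{E j} E k - ∇_{E j} ∇_{E i} E k - ∇_{[E i, E j]} E k`. -/
def riemann (I : Set ℝ) (c : ι → ι → ι → ℝ) (τ : ι → ℝ) (g : ℝ → Matrix ι ι ℝ)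
    (l k i j : ι) (t : ℝ) : ℝ :=
  frameDeriv I τ i (christoffel I c τ g l j k) t - frameDeriv I τ j (christoffel I c τ g l i k) t
    + ∑ m, (christoffel I c τ g m j k t * christoffel I c τ g l i m t
        - christoffel I c τ g m i k t * christoffel I c τ g l j m t
        - c i j m * christoffel I c τ g l m k t)

/-- The Ricci tensor, `Rc(Y, Z) = tr (X ↦ R(X, Y) Z)`. -/
def ricci (I : Set ℝ) (c : ι → ι → ι → ℝ) (τ : ι → ℝ) (g : ℝ → Matrix ι ι ℝ) (t : ℝ) :
    Matrix ι ι ℝ :=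
  Matrix.of fun j k => ∑ i, riemann I c τ g i k i j t

/-- The scalar curvature. -/
def scalar (I : Set ℝ) (c : ι → ι → ι → ℝ) (τ : ι → ℝ) (g : ℝ → Matrix ι ι ℝ) (t : ℝ) : ℝ :=
  metricTrace (g t) (ricci I c τ g t)

/-- The differential of a function `f` of time, as a covector. -/
def gradient (I : Set ℝ) (τ : ι → ℝ) (f : ℝ → ℝ) (t : ℝ) (i : ι) : ℝ :=
  frameDeriv I τ i f t

/-- The tensor product of the differential of `f` with itself. -/
def gradientSq (I : Set ℝ) (τ : ι → ℝ) (f : ℝ → ℝ) (t : ℝ) : Matrix ι ι ℝ :=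
  Matrix.of fun i j => gradient I τ f t i * gradient I τ f t j

/-- The covariant Hessian `∇² f (E i, E j) = E i (E j f) - (∇_{E i} E j) f`. -/
def hessian (I : Set ℝ) (c : ι → ι → ι → ℝ) (τ : ι → ℝ) (g : ℝ → Matrix ι ι ℝ) (f : ℝ → ℝ)
    (t : ℝ) : Matrix ι ι ℝ :=
  Matrix.of fun i j => frameDeriv I τ i (frameDeriv I τ j f) t
    - ∑ m, christoffel I c τ g m i j t * frameDeriv I τ m f t

/-- The wave operator, the trace of the covariant Hessian. -/
def box (I : Set ℝ) (c : ι → ι → ι → ℝ) (τ : ι → ℝ) (g : ℝ → Matrix ι ι ℝ) (f : ℝ → ℝ)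
    (t : ℝ) : ℝ :=
  metricTrace (g t) (hessian I c τ g f t)

/-- The covariant derivative `(∇_{E i} B)(E j, E k)` of a covariant 2-tensor `B`. -/
def covDeriv (I : Set ℝ) (c : ι → ι → ι → ℝ) (τ : ι → ℝ) (g B : ℝ → Matrix ι ι ℝ)
    (i j k : ι) (t : ℝ) : ℝ :=
  frameDeriv I τ i (fun s => B s j k) t
    - ∑ m, (christoffel I c τ g m i j t * B t m k + christoffel I c τ g m i k t * B t j m)

/-- The divergence of a symmetric covariant 2-tensor `B`, as a covector. -/
def divergence (I : Set ℝ) (c : ι → ι → ι → ℝ) (τ : ι → ℝ) (g B : ℝ → Matrix ι ι ℝ) (t : ℝ)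
    (k : ι) : ℝ :=
  ∑ i, ∑ j, (g t)⁻¹ i j * covDeriv I c τ g B i j k t

end Frame

/-! ### The Lie algebra and the space-time -/

/-- The structure constants of a Lie algebra in a basis: `[e i, e j] = ∑ k, c i j k • e k`. -/
def structureConstants {n : ℕ} {𝔤 : Type*} [LieRing 𝔤] [LieAlgebra ℝ 𝔤]
    (e : Module.Basis (Fin n) ℝ 𝔤) (i j k : Fin n) : ℝ :=
  e.repr ⁅e i, e j⁆ k

/-- The scalar curvature of the left invariant Riemannian metric whose matrix is `P` in a left
invariant frame with structure constants `c`. -/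
def leftInvariantScalar {n : ℕ} (c : Fin n → Fin n → Fin n → ℝ) (P : Matrix (Fin n) (Fin n) ℝ) :
    ℝ :=
  scalar univ c 0 (fun _ => P) 0

/-- The structure constants of the frame `∂_t, E_1, …, E_n` of `G × I`; `∂_t` commutes with
every left invariant field. -/
def spacetimeConstants {n : ℕ} (c : Fin n → Fin n → Fin n → ℝ) :
    Unit ⊕ Fin n → Unit ⊕ Fin n → Unit ⊕ Fin n → ℝ
  | Sum.inr i, Sum.inr j, Sum.inr k => c i j k
  | _, _, _ => 0

/-- `∂_t f = f'` and `E_i f = 0` for functions `f` of time. -/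
def spacetimeDir {n : ℕ} : Unit ⊕ Fin n → ℝ :=
  Sum.elim (fun _ => 1) (fun _ => 0)

/-- The Lorentzian metric `γ - dt ⊗ dt`. -/
def spacetimeMetric {n : ℕ} (γ : ℝ → Matrix (Fin n) (Fin n) ℝ) (t : ℝ) :
    Matrix (Unit ⊕ Fin n) (Unit ⊕ Fin n) ℝ :=
  Matrix.fromBlocks (Matrix.of fun _ _ => -1) 0 0 (γ t)

/-- The energy-momentum tensor `S - j ⊗ dt - dt ⊗ j + ρ dt ⊗ dt`. -/
def energyMomentum {n : ℕ} (ρ : ℝ → ℝ) (j : ℝ → Fin n → ℝ) (S : ℝ → Matrix (Fin n) (Fin n) ℝ)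
    (t : ℝ) : Matrix (Unit ⊕ Fin n) (Unit ⊕ Fin n) ℝ :=
  Matrix.fromBlocks (Matrix.of fun _ _ => ρ t) (Matrix.of fun _ i => -j t i)
    (Matrix.of fun i _ => -j t i) (S t)

/-- The second fundamental form `k = -γ̇ / 2`. -/
def secondForm {n : ℕ} (I : Set ℝ) (γ : ℝ → Matrix (Fin n) (Fin n) ℝ) (t : ℝ) :
    Matrix (Fin n) (Fin n) ℝ :=
  Matrix.of fun i j => -(1 / 2) * derivWithin (fun s => γ s i j) I t

/-- The negative of the mean curvature, `H = -tr_γ k / n`. -/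
def hubble {n : ℕ} (I : Set ℝ) (γ : ℝ → Matrix (Fin n) (Fin n) ℝ) (t : ℝ) : ℝ :=
  -metricTrace (γ t) (secondForm I γ t) / n

/-- The norm of a covector with respect to a Riemannian metric. -/
def covectorNorm {n : ℕ} (P : Matrix (Fin n) (Fin n) ℝ) (v : Fin n → ℝ) : ℝ :=
  √(∑ i, ∑ k, P⁻¹ i k * (v i * v k))

/-! ### Coupled quintessence -/

/-- Regularity of the data on the time interval `I`: a `C²` family `γ` of Riemannian metrics, a
`C²` field `φ` with values in `J`, and `C¹` matter variables `ρ`, `j`, `S` with `S` symmetric. -/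
structure RegularData {n : ℕ} (I J : Set ℝ) (γ : ℝ → Matrix (Fin n) (Fin n) ℝ) (ρ : ℝ → ℝ)
    (j : ℝ → Fin n → ℝ) (S : ℝ → Matrix (Fin n) (Fin n) ℝ) (φ : ℝ → ℝ) : Prop where
  metric_posDef : ∀ t ∈ I, (γ t).PosDef
  metric_smooth : ∀ a b, ContDiffOn ℝ 2 (fun t => γ t a b) I
  density_smooth : ContDiffOn ℝ 1 ρ I
  flux_smooth : ∀ a, ContDiffOn ℝ 1 (fun t => j t a) I
  stress_symm : ∀ t ∈ I, (S t).IsSymm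
  stress_smooth : ∀ a b, ContDiffOn ℝ 1 (fun t => S t a b) I
  field_smooth : ContDiffOn ℝ 2 φ I
  field_mem : MapsTo φ I J

/-- The coupled Einstein-scalar field-matter equations on `G × I`, for the metric
`g = γ - dt ⊗ dt` and the energy-momentum tensor `T`:
* `Rc - R g / 2 = dφ ⊗ dφ - |dφ|² g / 2 - V(φ) g + C(φ) T`,
* `□ φ - V'(φ) = - c(φ) tr T`,
* `Div (C(φ) T) = c(φ) (tr T) dφ`.
The arguments `C` and `c` are the coupling functions, `sc` are the structure constants. -/
structure SolvesESM {n : ℕ} (sc : Fin n → Fin n → Fin n → ℝ) (I J : Set ℝ) (V C c : ℝ → ℝ)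
    (γ : ℝ → Matrix (Fin n) (Fin n) ℝ) (ρ : ℝ → ℝ) (j : ℝ → Fin n → ℝ)
    (S : ℝ → Matrix (Fin n) (Fin n) ℝ) (φ : ℝ → ℝ) : Prop where
  einstein : ∀ t ∈ I,
    ricci I (spacetimeConstants sc) spacetimeDir (spacetimeMetric γ) t
        - (1 / 2 * scalar I (spacetimeConstants sc) spacetimeDir (spacetimeMetric γ) t) •
          spacetimeMetric γ t
      = gradientSq I spacetimeDir φ t
        - (1 / 2 * metricTrace (spacetimeMetric γ t) (gradientSq I spacetimeDir φ t)) •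
          spacetimeMetric γ t
        - V (φ t) • spacetimeMetric γ t
        + C (φ t) • energyMomentum ρ j S t
  scalar_field : ∀ t ∈ I,
    box I (spacetimeConstants sc) spacetimeDir (spacetimeMetric γ) φ t - derivWithin V J (φ t)
      = -(c (φ t) * metricTrace (spacetimeMetric γ t) (energyMomentum ρ j S t))
  matter : ∀ t ∈ I, ∀ a,
    divergence I (spacetimeConstants sc) spacetimeDir (spacetimeMetric γ)
        (fun s => C (φ s) • energyMomentum ρ j S s) t a
      = c (φ t) * metricTrace (spacetimeMetric γ t) (energyMomentum ρ j S t)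
        * gradient I spacetimeDir φ t a

/-- The dominant and the strong energy condition, in the form
`|j| ≤ ρ`, `|tr S| ≤ n ρ`, `ρ + tr S ≥ 0`. -/
structure EnergyConditions {n : ℕ} (I : Set ℝ) (γ : ℝ → Matrix (Fin n) (Fin n) ℝ) (ρ : ℝ → ℝ)
    (j : ℝ → Fin n → ℝ) (S : ℝ → Matrix (Fin n) (Fin n) ℝ) : Prop where
  flux_le : ∀ t ∈ I, covectorNorm (γ t) (j t) ≤ ρ t
  stress_le : ∀ t ∈ I, |metricTrace (γ t) (S t)| ≤ n * ρ t
  strong : ∀ t ∈ I, 0 ≤ ρ t + metricTrace (γ t) (S t)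

/-- The assumptions on the coupling functions `C` and `c`. -/
structure AdmissibleCoupling (J : Set ℝ) (C c : ℝ → ℝ) : Prop where
  smooth : ContDiffOn ℝ 1 C J
  continuous : ContinuousOn c J
  nonneg : ∀ x ∈ J, 0 ≤ C x
  bound : ∃ C₀ : ℝ, ∀ x ∈ J, |c x| ≤ C₀ * C x

/-- The assumptions on the potential `V`. -/
structure AdmissiblePotential (J : Set ℝ) (V : ℝ → ℝ) : Prop where
  smooth : ContDiffOn ℝ 1 V J
  pos : ∀ x ∈ J, 0 < V x
  /-- There is a positive lower semi-continuous minorant on the closure of `J` in `ℝ`. -/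
  minorant : ∃ U : ℝ → ℝ, LowerSemicontinuousOn U (closure J) ∧ (∀ x ∈ closure J, 0 < U x) ∧
    ∀ x ∈ J, U x ≤ V x
  /-- The derivative is bounded on every subset of `J` on which `V` is bounded. -/
  deriv_bounded : ∀ A ⊆ J, (∃ K, ∀ x ∈ A, |V x| ≤ K) → ∃ K, ∀ x ∈ A, |derivWithin V J x| ≤ K
  /-- The derivative extends continuously, with extended real values, to the closure of `J` in
  the extended real line. -/
  deriv_extends : ∃ F : EReal → EReal,
    ContinuousOn F (closure ((fun x : ℝ => (x : EReal)) '' J)) ∧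
    ∀ x ∈ J, F (x : EReal) = ((derivWithin V J x : ℝ) : EReal)

/-- The asymptotic steepness `limsup |V'| / V` of `V`, as `x ∈ J` tends to `+∞` (`l = atTop`) or
to `-∞` (`l = atBot`). -/
def steepness (J : Set ℝ) (V : ℝ → ℝ) (l : Filter ℝ) : EReal :=
  limsup (fun x => ((|derivWithin V J x| / V x : ℝ) : EReal)) (l ⊓ 𝓟 J)

/-- `W = n (n - 1) H² / (2 V(φ))`. -/
def wQuantity {n : ℕ} (I : Set ℝ) (V : ℝ → ℝ) (γ : ℝ → Matrix (Fin n) (Fin n) ℝ) (φ : ℝ → ℝ)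
    (t : ℝ) : ℝ :=
  n * (n - 1) * hubble I γ t ^ 2 / (2 * V (φ t))

end Quintessence

end

/-! The field equations are first reduced to ordinary differential (in)equalities. Write ψ = φ', D =
-H', m = C(φ)ρ, p = C(φ) tr S, let r ≤ 0 be the scalar curvature of γ and s ≥ 0 the squared norm of
the trace-free part of γ̇/2. The time-time component and the spatial trace of Einstein's equations
give n(n-1)H² = ψ² + 2V + 2m + s - r and n(n-1)D = nψ² + nm + p + ns - r. With the energy conditions
and n ≥ 3 these yield the inequalities of `ReducedSystem` (`SolvesESM.exists_reducedSystem`).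

Since V > 0, H cannot vanish, so H is positive and decreasing, and D, hence ψ² ≤ (n-1)D, is
integrable. As V and V' stay bounded along φ, ψ' is bounded, so ψ → 0 (`tendsto_velocity`). The
energy ψ²/2 + V increases only through the matter term, which is bounded by a multiple of D; hence
V(φ) converges (`exists_tendsto_potential`), necessarily to its infimum 0. The lower semicontinuous
minorant then forces |φ| → ∞, and by continuity φ keeps one sign.

For the bound on W, the identity (log W)' = -2D/H - V'ψ/V is combined with D ≥ ψ²/n + (1 - 1/W)H².
If |V'| ≤ βV, completing the square in ψ shows that log W decreases at least at the rate 2(y -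
nβ²/16)H wherever 1 - 1/W ≥ y. Since H ≥ 1/(n(t - t₀) + 1/H(t₀)) is not integrable, W eventually
stays below 1/(1 - y) for every y in (nβ²/16, 1) (`eventually_ratio_ge`). In the stated range of α,
nα²/16 is at most ½√((n-1)/n) α (`sq_steepness_le`), so the claimed bound follows. -/

noncomputable section

namespace Quintessence

/-! ### Curvature of γ - dt² in terms of γ and its expansion tensor. -/

section Geometry

variable {n : ℕ} {sc : Fin n → Fin n → Fin n → ℝ} {I : Set ℝ} {γ : ℝ → Matrix (Fin n) (Fin n) ℝ}
  {t : ℝ}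

/-- The tensor `γ̇ / 2`, which is minus the second fundamental form. -/
def expansion (I : Set ℝ) (γ : ℝ → Matrix (Fin n) (Fin n) ℝ) (t : ℝ) :
    Matrix (Fin n) (Fin n) ℝ :=
  Matrix.of fun i j => 1 / 2 * derivWithin (fun s => γ s i j) I t

/-- The tensor `γ̇ / 2` with one index raised. -/
def mixedExpansion (I : Set ℝ) (γ : ℝ → Matrix (Fin n) (Fin n) ℝ) (t : ℝ) :
    Matrix (Fin n) (Fin n) ℝ :=
  (γ t)⁻¹ * expansion I γ t

lemma spacetimeMetric_inv (h : (γ t).PosDef) :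
    (spacetimeMetric γ t)⁻¹ = Matrix.fromBlocks (Matrix.of fun _ _ => -1) 0 0 (γ t)⁻¹ := by
  apply Matrix.inv_eq_right_inv
  have h1 : (Matrix.of fun _ _ => (-1 : ℝ) : Matrix Unit Unit ℝ) * (Matrix.of fun _ _ => -1) = 1 := by
    ext i j
    simp [Matrix.mul_apply]
  rw [spacetimeMetric, Matrix.fromBlocks_multiply, h1,
    Matrix.mul_nonsing_inv _ ((Matrix.isUnit_iff_isUnit_det _).1 h.isUnit)]
  simp

@[simp] lemma spacetimeMetric_inl_inl (a b : Unit) :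
    spacetimeMetric γ t (Sum.inl a) (Sum.inl b) = -1 := rfl

@[simp] lemma spacetimeMetric_inl_inr (a : Unit) (j : Fin n) :
    spacetimeMetric γ t (Sum.inl a) (Sum.inr j) = 0 := rfl

@[simp] lemma spacetimeMetric_inr_inl (a : Unit) (j : Fin n) :
    spacetimeMetric γ t (Sum.inr j) (Sum.inl a) = 0 := rfl

@[simp] lemma spacetimeMetric_inr_inr (i j : Fin n) :
    spacetimeMetric γ t (Sum.inr i) (Sum.inr j) = γ t i j := rfl

@[simp] lemma spacetimeConstants_inl_left (a : Unit) (i j : Unit ⊕ Fin n) :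
    spacetimeConstants sc (Sum.inl a) i j = 0 := by
  cases i <;> cases j <;> rfl

@[simp] lemma spacetimeConstants_inl_middle (a : Unit) (i j : Unit ⊕ Fin n) :
    spacetimeConstants sc i (Sum.inl a) j = 0 := by
  cases i <;> cases j <;> rfl

@[simp] lemma spacetimeConstants_inl_right (a : Unit) (i j : Unit ⊕ Fin n) :
    spacetimeConstants sc i j (Sum.inl a) = 0 := by
  cases i <;> cases j <;> rfl

@[simp] lemma spacetimeConstants_inr (i j k : Fin n) :
    spacetimeConstants sc (Sum.inr i) (Sum.inr j) (Sum.inr k) = sc i j k := rfl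

@[simp] lemma frameDeriv_inl (a : Unit) (f : ℝ → ℝ) :
    frameDeriv I (spacetimeDir (n := n)) (Sum.inl a) f t = derivWithin f I t := by
  simp [frameDeriv, spacetimeDir]

@[simp] lemma frameDeriv_inr (i : Fin n) (f : ℝ → ℝ) :
    frameDeriv I spacetimeDir (Sum.inr i) f t = 0 := by
  simp [frameDeriv, spacetimeDir]

@[simp] lemma frameDeriv_zero {ι : Type*} (i : ι) (f : ℝ → ℝ) : frameDeriv I 0 i f t = 0 := by
  simp [frameDeriv]

lemma metricTrace_spacetime (h : (γ t).PosDef) (B : Matrix (Unit ⊕ Fin n) (Unit ⊕ Fin n) ℝ) :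
    metricTrace (spacetimeMetric γ t) B
      = -B (Sum.inl ()) (Sum.inl ()) + metricTrace (γ t) B.toBlocks₂₂ := by
  simp [metricTrace, spacetimeMetric_inv h, Fintype.sum_sum_type, Matrix.toBlocks₂₂]

lemma metricTrace_eq_trace {P B : Matrix (Fin n) (Fin n) ℝ} (hB : B.IsSymm) :
    metricTrace P B = (P⁻¹ * B).trace := by
  simp only [metricTrace, Matrix.trace, Matrix.diag, Matrix.mul_apply]
  exact Finset.sum_congr rfl fun i _ => Finset.sum_congr rfl fun j _ => by rw [hB.apply]

lemma christoffel_inl_inl_inl (h : (γ t).PosDef) :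
    christoffel I (spacetimeConstants sc) spacetimeDir (spacetimeMetric γ)
      (Sum.inl ()) (Sum.inl ()) (Sum.inl ()) t = 0 := by
  simp [christoffel, spacetimeMetric_inv h, Fintype.sum_sum_type]

lemma christoffel_inl_inl_inr (h : (γ t).PosDef) (j : Fin n) :
    christoffel I (spacetimeConstants sc) spacetimeDir (spacetimeMetric γ)
      (Sum.inl ()) (Sum.inl ()) (Sum.inr j) t = 0 := by
  simp [christoffel, spacetimeMetric_inv h, Fintype.sum_sum_type]

lemma christoffel_inl_inr_inl (h : (γ t).PosDef) (j : Fin n) :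
    christoffel I (spacetimeConstants sc) spacetimeDir (spacetimeMetric γ)
      (Sum.inl ()) (Sum.inr j) (Sum.inl ()) t = 0 := by
  simp [christoffel, spacetimeMetric_inv h, Fintype.sum_sum_type]

lemma christoffel_inl_inr_inr (h : (γ t).PosDef) (i j : Fin n) :
    christoffel I (spacetimeConstants sc) spacetimeDir (spacetimeMetric γ)
      (Sum.inl ()) (Sum.inr i) (Sum.inr j) t = expansion I γ t i j := by
  simp [christoffel, spacetimeMetric_inv h, Fintype.sum_sum_type, expansion]

lemma christoffel_inr_inl_inl (h : (γ t).PosDef) (k : Fin n) :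
    christoffel I (spacetimeConstants sc) spacetimeDir (spacetimeMetric γ)
      (Sum.inr k) (Sum.inl ()) (Sum.inl ()) t = 0 := by
  simp [christoffel, spacetimeMetric_inv h, Fintype.sum_sum_type]

lemma _root_.Matrix.PosDef.isSymm {P : Matrix (Fin n) (Fin n) ℝ} (h : P.PosDef) : P.IsSymm :=
  h.isHermitian

lemma expansion_isSymm (hγ : ∀ s ∈ I, (γ s).IsSymm) (ht : t ∈ I) : (expansion I γ t).IsSymm := by
  ext i j
  simp only [expansion, Matrix.transpose_apply, Matrix.of_apply]
  rw [derivWithin_congr (fun s hs => (hγ s hs).apply i j) ((hγ t ht).apply i j)]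

lemma christoffel_inr_inl_inr (hγ : ∀ s ∈ I, (γ s).PosDef) (ht : t ∈ I) (k j : Fin n) :
    christoffel I (spacetimeConstants sc) spacetimeDir (spacetimeMetric γ)
      (Sum.inr k) (Sum.inl ()) (Sum.inr j) t = mixedExpansion I γ t k j := by
  have hs := expansion_isSymm (fun s hs => (hγ s hs).isSymm) ht
  have : mixedExpansion I γ t k j = ∑ l, (γ t)⁻¹ k l * expansion I γ t j l := by
    simp only [mixedExpansion, Matrix.mul_apply]
    exact Finset.sum_congr rfl fun i _ => by rw [hs.apply]
  rw [this]
  simp [christoffel, spacetimeMetric_inv (hγ t ht), Fintype.sum_sum_type, expansion, Finset.mul_sum]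
  exact Finset.sum_congr rfl fun i _ => by ring

lemma christoffel_inr_inr_inl (hγ : ∀ s ∈ I, (γ s).PosDef) (ht : t ∈ I) (k j : Fin n) :
    christoffel I (spacetimeConstants sc) spacetimeDir (spacetimeMetric γ)
      (Sum.inr k) (Sum.inr j) (Sum.inl ()) t = mixedExpansion I γ t k j := by
  rw [← christoffel_inr_inl_inr (sc := sc) hγ ht]
  simp [christoffel, spacetimeMetric_inv (hγ t ht), Fintype.sum_sum_type]

/-- Spatial frame fields annihilate functions of time and the metric is block diagonal, so only the
bracket terms of the Koszul formula survive. On the right the metric is frozen and the last argument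
`0` is a dummy time. -/
lemma christoffel_inr_inr_inr (h : (γ t).PosDef) (k i j : Fin n) :
    christoffel I (spacetimeConstants sc) spacetimeDir (spacetimeMetric γ)
      (Sum.inr k) (Sum.inr i) (Sum.inr j) t = christoffel univ sc 0 (fun _ => γ t) k i j 0 := by
  simp [christoffel, spacetimeMetric_inv h, Fintype.sum_sum_type]

/-! ### Differentiation of the inverse metric. -/

section Smoothness

/-- By Cramer's rule the entries are quotients of polynomials in the entries of γ, with denominator
det γ ≠ 0. -/
lemma differentiableWithinAt_inv_apply (h : (γ t).PosDef)
    (hd : ∀ a b, DifferentiableWithinAt ℝ (fun s => γ s a b) I t) (a b : Fin n) :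
    DifferentiableWithinAt ℝ (fun s => (γ s)⁻¹ a b) I t := by
  have hdet : ∀ M : ℝ → Matrix (Fin n) (Fin n) ℝ,
      (∀ a b, DifferentiableWithinAt ℝ (fun s => M s a b) I t) →
      DifferentiableWithinAt ℝ (fun s => (M s).det) I t := by
    intro M hM
    simp only [Matrix.det_apply]
    exact DifferentiableWithinAt.fun_sum fun σ _ =>
      (DifferentiableWithinAt.fun_finsetProd fun i _ => hM _ _).const_smul _
  have h1 : (fun s => (γ s)⁻¹ a b) = fun s => (γ s).det⁻¹ * (γ s).adjugate a b := by
    ext s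
    simp [Matrix.inv_def]
  rw [h1]
  refine ((hdet γ hd).inv h.det_pos.ne').mul ?_
  simp only [Matrix.adjugate_apply]
  apply hdet
  intro i j
  by_cases hi : i = b
  · subst hi
    simp only [Matrix.updateRow_self]
    exact differentiableWithinAt_const _
  · simpa [Matrix.updateRow_ne hi] using hd i j

/-- Differentiate γ⁻¹γ = 1; the factor 2 appears because `expansion` is half of γ̇. -/
lemma derivWithin_inv_apply (hI : UniqueDiffWithinAt ℝ I t) (hγ : ∀ s ∈ I, (γ s).PosDef)
    (ht : t ∈ I) (hd : ∀ a b, DifferentiableWithinAt ℝ (fun s => γ s a b) I t) (a b : Fin n) :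
    derivWithin (fun s => (γ s)⁻¹ a b) I t
      = -2 * ((γ t)⁻¹ * expansion I γ t * (γ t)⁻¹) a b := by
  set D : Matrix (Fin n) (Fin n) ℝ := Matrix.of fun i j => derivWithin (fun s => (γ s)⁻¹ i j) I t
    with hD
  have hu : ∀ s ∈ I, IsUnit (γ s).det := fun s hs =>
    (Matrix.isUnit_iff_isUnit_det _).1 (hγ s hs).isUnit
  have key : D * γ t + (γ t)⁻¹ * ((2 : ℝ) • expansion I γ t) = 0 := by
    ext i j
    have h1 : HasDerivWithinAt (fun s => ∑ k, (γ s)⁻¹ i k * γ s k j)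
        (∑ k, (D i k * γ t k j + (γ t)⁻¹ i k * derivWithin (fun s => γ s k j) I t)) I t :=
      HasDerivWithinAt.fun_sum fun k _ =>
        (differentiableWithinAt_inv_apply (hγ t ht) hd i k).hasDerivWithinAt.mul
          (hd k j).hasDerivWithinAt
    have h2 : HasDerivWithinAt (fun s => ∑ k, (γ s)⁻¹ i k * γ s k j) 0 I t := by
      refine (hasDerivWithinAt_const t I ((1 : Matrix (Fin n) (Fin n) ℝ) i j)).congr_of_mem ?_ ht
      intro s hs
      rw [← Matrix.nonsing_inv_mul _ (hu s hs), Matrix.mul_apply]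
    have h3 := hI.eq_deriv _ h1 h2
    simp only [Matrix.add_apply, Matrix.mul_apply, Matrix.zero_apply, ← Finset.sum_add_distrib]
    rw [← h3]
    refine Finset.sum_congr rfl fun k _ => ?_
    simp [expansion]
  have h4 : D = -2 • ((γ t)⁻¹ * expansion I γ t * (γ t)⁻¹) := by
    have h5 : D * γ t = -((γ t)⁻¹ * ((2 : ℝ) • expansion I γ t)) := eq_neg_of_add_eq_zero_left key
    calc D = D * γ t * (γ t)⁻¹ := by rw [Matrix.mul_nonsing_inv_cancel_right _ _ (hu t ht)]
      _ = _ := by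
        rw [h5]
        ext a b
        simp [Matrix.mul_assoc]
  have h6 := congrFun (congrFun h4 a) b
  simpa [hD] using h6

end Smoothness

/-! ### Ricci curvature of the space-time metric. -/

/-- The metrics `γ` form a family of positive definite matrices, twice differentiable on `I`. -/
structure MetricFamily (I : Set ℝ) (γ : ℝ → Matrix (Fin n) (Fin n) ℝ) : Prop where
  uniqueDiff : UniqueDiffOn ℝ I
  posDef : ∀ t ∈ I, (γ t).PosDef
  smooth : ∀ a b, ContDiffOn ℝ 2 (fun t => γ t a b) I

namespace MetricFamily

lemma differentiable (h : MetricFamily I γ) (ht : t ∈ I) (a b : Fin n) :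
    DifferentiableWithinAt ℝ (fun s => γ s a b) I t :=
  (h.smooth a b).differentiableOn (by norm_num) t ht

lemma isSymm (h : MetricFamily I γ) (ht : t ∈ I) : (γ t).IsSymm := (h.posDef t ht).isSymm

lemma differentiable_expansion (h : MetricFamily I γ) (ht : t ∈ I) (a b : Fin n) :
    DifferentiableWithinAt ℝ (fun s => expansion I γ s a b) I t := by
  have h1 : ContDiffOn ℝ 1 (derivWithin (fun s => γ s a b) I) I :=
    (h.smooth a b).derivWithin h.uniqueDiff (by norm_num)
  exact (h1.differentiableOn (by norm_num) t ht).const_mul _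

lemma differentiable_inv (h : MetricFamily I γ) (ht : t ∈ I) (a b : Fin n) :
    DifferentiableWithinAt ℝ (fun s => (γ s)⁻¹ a b) I t :=
  differentiableWithinAt_inv_apply (h.posDef t ht) (fun _ _ => h.differentiable ht _ _) a b

lemma differentiable_mixedExpansion (h : MetricFamily I γ) (ht : t ∈ I) (a b : Fin n) :
    DifferentiableWithinAt ℝ (fun s => mixedExpansion I γ s a b) I t := by
  simp only [mixedExpansion, Matrix.mul_apply]
  exact DifferentiableWithinAt.fun_sum fun k _ =>
    (h.differentiable_inv ht a k).mul (h.differentiable_expansion ht k b)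

lemma isSymm_expansion (h : MetricFamily I γ) (ht : t ∈ I) : (expansion I γ t).IsSymm :=
  expansion_isSymm (fun _ hs => h.isSymm hs) ht

lemma derivWithin_trace (h : MetricFamily I γ) (ht : t ∈ I) :
    derivWithin (fun s => (mixedExpansion I γ s).trace) I t
      = metricTrace (γ t) (Matrix.of fun i j => derivWithin (fun s => expansion I γ s i j) I t)
        - 2 * (mixedExpansion I γ t * mixedExpansion I γ t).trace := by
  have h1 : HasDerivWithinAt (fun s => ∑ i, ∑ j, (γ s)⁻¹ i j * expansion I γ s i j)
      (∑ i, ∑ j, (derivWithin (fun s => (γ s)⁻¹ i j) I t * expansion I γ t i j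
        + (γ t)⁻¹ i j * derivWithin (fun s => expansion I γ s i j) I t)) I t :=
    HasDerivWithinAt.fun_sum fun i _ => HasDerivWithinAt.fun_sum fun j _ =>
      (h.differentiable_inv ht i j).hasDerivWithinAt.mul
        (h.differentiable_expansion ht i j).hasDerivWithinAt
  have h2 := (h1.congr_of_mem (f₁ := fun s => (mixedExpansion I γ s).trace) (fun s hs => by
    rw [mixedExpansion, ← metricTrace_eq_trace (h.isSymm_expansion hs), metricTrace]) ht).derivWithin
      (h.uniqueDiff t ht)
  rw [h2]
  have h3 : (mixedExpansion I γ t * mixedExpansion I γ t).trace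
      = ∑ i, ∑ j, ((γ t)⁻¹ * expansion I γ t * (γ t)⁻¹) i j * expansion I γ t i j := by
    rw [mixedExpansion, ← Matrix.mul_assoc, Matrix.trace]
    simp only [Matrix.diag]
    refine Finset.sum_congr rfl fun i _ => ?_
    rw [Matrix.mul_apply]
    exact Finset.sum_congr rfl fun j _ => by rw [(h.isSymm_expansion ht).apply i j]
  simp only [derivWithin_inv_apply (h.uniqueDiff t ht) h.posDef ht
    (fun _ _ => h.differentiable ht _ _), h3, metricTrace, Finset.mul_sum,
    ← Finset.sum_sub_distrib, Matrix.of_apply]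
  exact Finset.sum_congr rfl fun i _ => Finset.sum_congr rfl fun j _ => by ring

lemma ricci_inl_inl (h : MetricFamily I γ) (ht : t ∈ I) :
    ricci I (spacetimeConstants sc) spacetimeDir (spacetimeMetric γ) t (Sum.inl ()) (Sum.inl ())
      = -derivWithin (fun s => (mixedExpansion I γ s).trace) I t
        - (mixedExpansion I γ t * mixedExpansion I γ t).trace := by
  have hp := h.posDef t ht
  have h1 : ∀ i : Fin n, derivWithin (christoffel I (spacetimeConstants sc) spacetimeDir
      (spacetimeMetric γ) (Sum.inr i) (Sum.inr i) (Sum.inl ())) I t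
      = derivWithin (fun s => mixedExpansion I γ s i i) I t := fun i =>
    derivWithin_congr (fun s hs => christoffel_inr_inr_inl h.posDef hs i i)
      (christoffel_inr_inr_inl h.posDef ht i i)
  have h2 : derivWithin (fun s => (mixedExpansion I γ s).trace) I t
      = ∑ i, derivWithin (fun s => mixedExpansion I γ s i i) I t := by
    simp only [Matrix.trace, Matrix.diag]
    exact derivWithin_fun_sum fun i _ => h.differentiable_mixedExpansion ht i i
  rw [h2]
  simp [ricci, riemann, Fintype.sum_sum_type, h1,
    christoffel_inl_inl_inl hp, christoffel_inl_inl_inr hp, christoffel_inl_inr_inl hp,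
    christoffel_inr_inl_inl hp, christoffel_inr_inl_inr h.posDef ht,
    christoffel_inr_inr_inl h.posDef ht, Matrix.trace, Matrix.mul_apply,
    Finset.sum_add_distrib]
  rw [sub_eq_add_neg]
  congr 2
  exact Finset.sum_congr rfl fun i _ => Finset.sum_congr rfl fun j _ => mul_comm _ _

lemma ricci_inr_inr (h : MetricFamily I γ) (ht : t ∈ I) (j k : Fin n) :
    ricci I (spacetimeConstants sc) spacetimeDir (spacetimeMetric γ) t (Sum.inr j) (Sum.inr k)
      = ricci univ sc 0 (fun _ => γ t) 0 j k + derivWithin (fun s => expansion I γ s j k) I t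
        + (mixedExpansion I γ t).trace * expansion I γ t j k
        - (expansion I γ t * mixedExpansion I γ t) j k
        - (expansion I γ t * mixedExpansion I γ t) k j := by
  have hp := h.posDef t ht
  have h1 : derivWithin (christoffel I (spacetimeConstants sc) spacetimeDir
      (spacetimeMetric γ) (Sum.inl ()) (Sum.inr j) (Sum.inr k)) I t
      = derivWithin (fun s => expansion I γ s j k) I t :=
    derivWithin_congr (fun s hs => christoffel_inl_inr_inr (h.posDef s hs) j k)
      (christoffel_inl_inr_inr hp j k)
  simp [ricci, riemann, Fintype.sum_sum_type, h1,
    christoffel_inl_inl_inl hp, christoffel_inl_inl_inr hp, christoffel_inl_inr_inl hp,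
    christoffel_inr_inl_inr h.posDef ht, christoffel_inl_inr_inr hp,
    christoffel_inr_inr_inl h.posDef ht, christoffel_inr_inr_inr hp,
    Matrix.trace, Matrix.mul_apply,
    Finset.sum_add_distrib]
  have h2 : ∑ x, expansion I γ t x k * mixedExpansion I γ t x j
      = ∑ x, expansion I γ t k x * mixedExpansion I γ t x j :=
    Finset.sum_congr rfl fun x _ => by rw [(h.isSymm_expansion ht).apply k x]
  have h3 : ∑ x, mixedExpansion I γ t x k * expansion I γ t j x
      = ∑ x, expansion I γ t j x * mixedExpansion I γ t x k :=
    Finset.sum_congr rfl fun x _ => mul_comm _ _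
  rw [h2, h3, ← Finset.mul_sum]
  ring

/-- Both quadratic terms of `ricci_inr_inr` have trace tr(K²), with K = `mixedExpansion`. They
cancel the 2 tr(K²) that arises when the time derivative is moved outside the trace. -/
lemma metricTrace_ricci (h : MetricFamily I γ) (ht : t ∈ I) :
    metricTrace (γ t)
      (ricci I (spacetimeConstants sc) spacetimeDir (spacetimeMetric γ) t).toBlocks₂₂
      = leftInvariantScalar sc (γ t)
        + derivWithin (fun s => (mixedExpansion I γ s).trace) I t
        + (mixedExpansion I γ t).trace ^ 2 := by
  have h1 : metricTrace (γ t) (expansion I γ t) = (mixedExpansion I γ t).trace :=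
    metricTrace_eq_trace (h.isSymm_expansion ht)
  have hG : ((γ t)⁻¹).IsSymm := (h.posDef t ht).inv.isSymm
  have h2 : ∑ i, ∑ j, (γ t)⁻¹ i j * (expansion I γ t * mixedExpansion I γ t) j i
      = (mixedExpansion I γ t * mixedExpansion I γ t).trace := by
    conv_rhs => rw [mixedExpansion, Matrix.mul_assoc, ← mixedExpansion]
    simp only [Matrix.trace, Matrix.diag, Matrix.mul_apply (M := (γ t)⁻¹)]
  have h3 : ∑ i, ∑ j, (γ t)⁻¹ i j * (expansion I γ t * mixedExpansion I γ t) i j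
      = (mixedExpansion I γ t * mixedExpansion I γ t).trace := by
    rw [← h2, Finset.sum_comm]
    exact Finset.sum_congr rfl fun i _ => Finset.sum_congr rfl fun j _ => by rw [hG.apply]
  rw [h.derivWithin_trace ht, leftInvariantScalar, scalar]
  have h4 : metricTrace (γ t)
      (ricci I (spacetimeConstants sc) spacetimeDir (spacetimeMetric γ) t).toBlocks₂₂
      = metricTrace (γ t) (ricci univ sc 0 (fun _ => γ t) 0)
        + metricTrace (γ t) (Matrix.of fun i j => derivWithin (fun s => expansion I γ s i j) I t)
        + (mixedExpansion I γ t).trace * metricTrace (γ t) (expansion I γ t)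
        - ∑ i, ∑ j, (γ t)⁻¹ i j * (expansion I γ t * mixedExpansion I γ t) i j
        - ∑ i, ∑ j, (γ t)⁻¹ i j * (expansion I γ t * mixedExpansion I γ t) j i := by
    simp only [metricTrace, Matrix.toBlocks₂₂, Matrix.of_apply, h.ricci_inr_inr ht,
      Finset.mul_sum, ← Finset.sum_add_distrib, ← Finset.sum_sub_distrib]
    exact Finset.sum_congr rfl fun i _ => Finset.sum_congr rfl fun j _ => by ring
  rw [h4, h1, h2, h3]
  ring

/-- With P⁻¹ = QᵀQ the trace is the sum of the squared entries of QBQᵀ. -/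
lemma trace_mul_self_nonneg {P B : Matrix (Fin n) (Fin n) ℝ} (hP : P.PosDef) (hB : B.IsSymm) :
    0 ≤ (P⁻¹ * B * (P⁻¹ * B)).trace := by
  obtain ⟨Q, hQ⟩ : ∃ Q : Matrix (Fin n) (Fin n) ℝ, P⁻¹ = Q.transpose * Q := by
    open scoped MatrixOrder Matrix.Norms.L2Operator in
    exact CStarAlgebra.nonneg_iff_eq_star_mul_self.mp hP.inv.posSemidef.nonneg
  have h1 : (P⁻¹ * B * (P⁻¹ * B)).trace
      = ((Q * B * Q.transpose).transpose * (Q * B * Q.transpose)).trace := by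
    rw [hQ, Matrix.transpose_mul, Matrix.transpose_mul, Matrix.transpose_transpose, hB]
    simp only [Matrix.mul_assoc]
    rw [Matrix.trace_mul_comm]
    simp only [Matrix.mul_assoc]
  rw [h1, Matrix.trace]
  refine Finset.sum_nonneg fun i _ => ?_
  rw [Matrix.diag, Matrix.mul_apply]
  exact Finset.sum_nonneg fun j _ => mul_self_nonneg _

lemma trace_sq_le (h : MetricFamily I γ) (ht : t ∈ I) :
    (mixedExpansion I γ t).trace ^ 2
      ≤ n * (mixedExpansion I γ t * mixedExpansion I γ t).trace := by
  rcases Nat.eq_zero_or_pos n with rfl | hn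
  · simp [Matrix.trace]
  set θ := (mixedExpansion I γ t).trace with hθ
  have hn' : (0 : ℝ) < n := by exact_mod_cast hn
  -- The inequality says that the trace-free part of the expansion has non-negative squared norm.
  have h1 := trace_mul_self_nonneg (h.posDef t ht) (B := expansion I γ t - (θ / n) • γ t) (by
    rw [Matrix.IsSymm, Matrix.transpose_sub, Matrix.transpose_smul, h.isSymm ht,
      h.isSymm_expansion ht])
  have h2 : (γ t)⁻¹ * (expansion I γ t - (θ / n) • γ t)
      = mixedExpansion I γ t - (θ / n) • (1 : Matrix (Fin n) (Fin n) ℝ) := by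
    rw [Matrix.mul_sub, Matrix.mul_smul, Matrix.nonsing_inv_mul _
      ((Matrix.isUnit_iff_isUnit_det _).1 (h.posDef t ht).isUnit), mixedExpansion]
  rw [h2] at h1
  simp only [Matrix.mul_sub, Matrix.sub_mul, Matrix.smul_mul, Matrix.mul_smul, Matrix.trace_sub,
    Matrix.trace_smul, Matrix.mul_one, Matrix.one_mul, Matrix.trace_one, Fintype.card_fin,
    smul_eq_mul, ← hθ] at h1
  field_simp at h1
  nlinarith

end MetricFamily

end Geometry

/-! ### Asymptotics of the reduced ODE system. -/

section Evolution

/-- A function on `[t₀, ∞)` with non-positive derivative is antitone. -/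
lemma antitoneOn_Ici {t₀ : ℝ} {f f' : ℝ → ℝ}
    (hf : ∀ t ∈ Ici t₀, HasDerivWithinAt f (f' t) (Ici t₀) t) (hf' : ∀ t ∈ Ici t₀, f' t ≤ 0) :
    AntitoneOn f (Ici t₀) :=
  antitoneOn_of_hasDerivWithinAt_nonpos (convex_Ici _)
    (fun t ht => (hf t ht).continuousWithinAt)
    (fun t ht => (hf t (interior_subset ht)).mono interior_subset)
    (fun t ht => hf' t (interior_subset ht))

lemma exists_tendsto_of_antitoneOn {t₀ b : ℝ} {f : ℝ → ℝ} (hf : AntitoneOn f (Ici t₀))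
    (hb : ∀ t ∈ Ici t₀, b ≤ f t) : ∃ L, Tendsto f atTop (𝓝 L) := by
  -- Extending f by a constant to the left of t₀ makes it antitone on the whole line.
  have h1 : Antitone fun t => f (max t₀ t) := fun s t hst =>
    hf (mem_Ici.2 (le_max_left _ _)) (mem_Ici.2 (le_max_left _ _)) (max_le_max le_rfl hst)
  have h2 : BddBelow (range fun t => f (max t₀ t)) := by
    refine ⟨b, ?_⟩
    rintro _ ⟨t, rfl⟩
    exact hb _ (mem_Ici.2 (le_max_left _ _))
  refine ⟨_, (tendsto_atTop_ciInf h1 h2).congr' ?_⟩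
  filter_upwards [eventually_ge_atTop t₀] with t ht
  rw [max_eq_right ht]

/-- If the derivative of `f` is dominated by that of `-H`, where both functions are bounded below
and `H` is antitone, then `f` converges. -/
lemma exists_tendsto_of_deriv_le {t₀ M b : ℝ} {f f' H D : ℝ → ℝ}
    (hf : ∀ t ∈ Ici t₀, HasDerivWithinAt f (f' t) (Ici t₀) t)
    (hH : ∀ t ∈ Ici t₀, HasDerivWithinAt H (-D t) (Ici t₀) t)
    (hM : 0 ≤ M) (hD : ∀ t ∈ Ici t₀, 0 ≤ D t)
    (hfD : ∀ t ∈ Ici t₀, f' t ≤ M * D t) (hH0 : ∀ t ∈ Ici t₀, 0 ≤ H t)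
    (hb : ∀ t ∈ Ici t₀, b ≤ f t) : ∃ L, Tendsto f atTop (𝓝 L) := by
  obtain ⟨L₁, h1⟩ := exists_tendsto_of_antitoneOn
    (antitoneOn_Ici hH fun t ht => neg_nonpos.2 (hD t ht)) hH0
  -- Adding M H turns the one-sided derivative bound into monotonicity.
  obtain ⟨L₂, h2⟩ := exists_tendsto_of_antitoneOn (b := b) (f := fun t => f t + M * H t)
    (antitoneOn_Ici (fun t ht => (hf t ht).add ((hH t ht).const_mul M)) fun t ht => by
      linarith [hfD t ht])
    (fun t ht => by linarith [hb t ht, mul_nonneg hM (hH0 t ht)])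
  refine ⟨L₂ - M * L₁, (h2.sub (h1.const_mul M)).congr fun t => ?_⟩
  ring

/-- A function bounded below cannot have a derivative that stays below a negative constant. -/
lemma not_eventually_deriv_le {t₀ b δ : ℝ} (hδ : 0 < δ) {f f' : ℝ → ℝ}
    (hf : ∀ t ∈ Ici t₀, HasDerivWithinAt f (f' t) (Ici t₀) t) (hb : ∀ t ∈ Ici t₀, b ≤ f t)
    (h : ∀ᶠ t in atTop, f' t ≤ -δ) : False := by
  obtain ⟨a, ha⟩ := eventually_atTop.1 h
  set t₁ := max a t₀
  have hsub : Ici t₁ ⊆ Ici t₀ := Ici_subset_Ici.2 (le_max_right _ _)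
  have h1 : AntitoneOn (fun t => f t + δ * t) (Ici t₁) :=
    antitoneOn_Ici (f' := fun t => f' t + δ * 1)
      (fun t ht => ((hf t (hsub ht)).mono hsub).add ((hasDerivWithinAt_id t _).const_mul δ))
      fun t ht => by linarith [ha t ((le_max_left _ _).trans ht)]
  have h2 : ∀ t ∈ Ici t₁, t ≤ (f t₁ + δ * t₁ - b) / δ := fun t ht => by
    rw [le_div_iff₀ hδ]
    linarith [h1 self_mem_Ici ht ht, hb t (hsub ht)]
  have h3 := h2 (max t₁ ((f t₁ + δ * t₁ - b) / δ + 1)) (mem_Ici.2 (le_max_left _ _))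
  linarith [le_max_right t₁ ((f t₁ + δ * t₁ - b) / δ + 1)]

/-- The evolution of the mean curvature `H`, the scalar field `φ`, its velocity `ψ` and the
potential energy `v`, with `D = -H'` and `w` the derivative of the potential; `q` is the
contribution of matter to the field equation. -/
structure ReducedSystem (n κ t₀ : ℝ) (H D φ ψ v w q : ℝ → ℝ) : Prop where
  one_lt : 1 < n
  kappa_nonneg : 0 ≤ κ
  deriv_hubble : ∀ t ∈ Ici t₀, HasDerivWithinAt H (-D t) (Ici t₀) t
  deriv_field : ∀ t ∈ Ici t₀, HasDerivWithinAt φ (ψ t) (Ici t₀) t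
  deriv_velocity : ∀ t ∈ Ici t₀,
    HasDerivWithinAt ψ (-(n * H t * ψ t) - w t + q t) (Ici t₀) t
  deriv_potential : ∀ t ∈ Ici t₀, HasDerivWithinAt v (w t * ψ t) (Ici t₀) t
  potential_pos : ∀ t ∈ Ici t₀, 0 < v t
  energy_le : ∀ t ∈ Ici t₀, ψ t ^ 2 + 2 * v t ≤ n * (n - 1) * H t ^ 2
  le_decay : ∀ t ∈ Ici t₀,
    (n - 1) * ψ t ^ 2 + (n * (n - 1) * H t ^ 2 - 2 * v t) ≤ n * (n - 1) * D t
  decay_le : ∀ t ∈ Ici t₀, D t ≤ n * H t ^ 2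
  matter_le : ∀ t ∈ Ici t₀, |q t| ≤ κ * D t
  hubble_pos : 0 < H t₀

namespace ReducedSystem

variable {n κ t₀ : ℝ} {H D φ ψ v w q : ℝ → ℝ}

/-- At a zero of H the energy inequality would force v ≤ 0; the intermediate value theorem does the
rest. -/
lemma pos (h : ReducedSystem n κ t₀ H D φ ψ v w q) : ∀ t ∈ Ici t₀, 0 < H t := by
  intro t ht
  by_contra! hneg
  have hc : ContinuousOn H (Icc t₀ t) := fun s hs =>
    ((h.deriv_hubble s hs.1).continuousWithinAt).mono Icc_subset_Ici_self
  obtain ⟨s, hs, hs0⟩ := intermediate_value_Icc' ht hc ⟨hneg, h.hubble_pos.le⟩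
  have h1 := h.energy_le s hs.1
  rw [hs0] at h1
  nlinarith [h.potential_pos s hs.1, sq_nonneg (ψ s)]

lemma coeff_pos (h : ReducedSystem n κ t₀ H D φ ψ v w q) : 0 < n * (n - 1) := by
  have := h.one_lt
  exact mul_pos (by linarith) (by linarith)

/-- This makes ψ² integrable, since D = -H' and H is bounded below. -/
lemma sq_velocity_le (h : ReducedSystem n κ t₀ H D φ ψ v w q) {t : ℝ} (ht : t ∈ Ici t₀) :
    ψ t ^ 2 ≤ (n - 1) * D t := by
  have h1 := h.le_decay t ht
  have h2 := h.energy_le t ht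
  have h3 : n * ψ t ^ 2 ≤ n * ((n - 1) * D t) := by linarith
  exact le_of_mul_le_mul_left h3 (by linarith [h.one_lt])

lemma decay_nonneg (h : ReducedSystem n κ t₀ H D φ ψ v w q) : ∀ t ∈ Ici t₀, 0 ≤ D t := by
  intro t ht
  have h1 := h.sq_velocity_le ht
  by_contra! hD
  have := mul_neg_of_pos_of_neg (sub_pos.2 h.one_lt) hD
  linarith [sq_nonneg (ψ t)]

lemma antitone (h : ReducedSystem n κ t₀ H D φ ψ v w q) : AntitoneOn H (Ici t₀) :=
  antitoneOn_Ici h.deriv_hubble fun t ht => neg_nonpos.2 (h.decay_nonneg t ht)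

lemma sq_le (h : ReducedSystem n κ t₀ H D φ ψ v w q) {t : ℝ} (ht : t ∈ Ici t₀) :
    H t ^ 2 ≤ H t₀ ^ 2 :=
  pow_le_pow_left₀ (h.pos t ht).le (h.antitone self_mem_Ici ht ht) 2

lemma potential_le (h : ReducedSystem n κ t₀ H D φ ψ v w q) {t : ℝ} (ht : t ∈ Ici t₀) :
    v t ≤ n * (n - 1) * H t₀ ^ 2 := by
  have h1 := h.energy_le t ht
  have h2 := mul_le_mul_of_nonneg_left (h.sq_le ht) h.coeff_pos.le
  linarith [sq_nonneg (ψ t), h.potential_pos t ht]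

lemma exists_velocity_le (h : ReducedSystem n κ t₀ H D φ ψ v w q) :
    ∃ B, 0 < B ∧ ∀ t ∈ Ici t₀, |ψ t| ≤ B := by
  refine ⟨√(n * (n - 1) * H t₀ ^ 2), ?_, fun t ht => Real.abs_le_sqrt ?_⟩
  · exact Real.sqrt_pos.2 (mul_pos h.coeff_pos (pow_pos h.hubble_pos 2))
  · have h1 := h.energy_le t ht
    have h2 := mul_le_mul_of_nonneg_left (h.sq_le ht) h.coeff_pos.le
    linarith [h.potential_pos t ht]

/-- A Barbalat argument: ψ² is integrable and ψ' is bounded. It is run on ψ³, whose derivative 3ψ²ψ'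
is dominated by a multiple of D. -/
lemma tendsto_velocity (h : ReducedSystem n κ t₀ H D φ ψ v w q) {K : ℝ}
    (hw : ∀ t ∈ Ici t₀, |w t| ≤ K) : Tendsto ψ atTop (𝓝 0) := by
  have hn := h.one_lt
  obtain ⟨B, hB, hψ⟩ := h.exists_velocity_le
  have hK : 0 ≤ K := (abs_nonneg _).trans (hw t₀ self_mem_Ici)
  set A := n * H t₀ * B + K + κ * (n * H t₀ ^ 2) with hA
  have hn0 : 0 < n := by linarith
  have hA0 : 0 ≤ A := by
    have := h.hubble_pos
    have := h.kappa_nonneg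
    positivity
  have hacc : ∀ t ∈ Ici t₀, |-(n * H t * ψ t) - w t + q t| ≤ A := by
    intro t ht
    have h1 : |n * H t * ψ t| ≤ n * H t₀ * B := by
      rw [abs_mul, abs_of_nonneg (mul_nonneg hn0.le (h.pos t ht).le)]
      have := h.antitone self_mem_Ici ht ht
      have h5 := (h.pos t ht).le
      have := h.hubble_pos
      gcongr
      exact hψ t ht
    have h2 : |q t| ≤ κ * (n * H t₀ ^ 2) :=
      (h.matter_le t ht).trans (mul_le_mul_of_nonneg_left
        ((h.decay_le t ht).trans (mul_le_mul_of_nonneg_left (h.sq_le ht) hn0.le))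
        h.kappa_nonneg)
    have h3 := abs_add_le (-(n * H t * ψ t) - w t) (q t)
    have h4 := abs_sub (-(n * H t * ψ t)) (w t)
    rw [abs_neg] at h4
    linarith [hw t ht]
  have hcube : ∃ L, Tendsto (fun t => ψ t ^ 3) atTop (𝓝 L) := by
    refine exists_tendsto_of_deriv_le (M := 3 * A * (n - 1)) (b := -B ^ 3)
      (fun t ht => (h.deriv_velocity t ht).pow 3) h.deriv_hubble
      (mul_nonneg (by positivity) (by linarith)) h.decay_nonneg ?_ (fun t ht => (h.pos t ht).le) ?_
    · intro t ht
      have h1 := h.sq_velocity_le ht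
      have h2 := (le_abs_self _).trans (hacc t ht)
      have h3 : ψ t ^ 2 * (-(n * H t * ψ t) - w t + q t) ≤ ψ t ^ 2 * A :=
        mul_le_mul_of_nonneg_left h2 (sq_nonneg _)
      have h4 : ψ t ^ 2 * A ≤ (n - 1) * D t * A := mul_le_mul_of_nonneg_right h1 hA0
      norm_num
      linarith
    · intro t ht
      have h1 : |ψ t ^ 3| ≤ B ^ 3 := by
        rw [abs_pow]
        exact pow_le_pow_left₀ (abs_nonneg _) (hψ t ht) 3
      exact (abs_le.1 h1).1
  obtain ⟨L, hL⟩ := hcube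
  have hL0 : L = 0 := by
    by_contra hne
    have hpos : 0 < |L| := abs_pos.2 hne
    -- If ψ³ had a non-zero limit, then |ψ³| ≤ Bψ² ≤ B(n-1)D would keep D above δ and drive H to -∞.
    refine not_eventually_deriv_le (δ := |L| / 2 / B / (n - 1)) (b := 0)
      (div_pos (by positivity) (by linarith)) h.deriv_hubble (fun t ht => (h.pos t ht).le) ?_
    filter_upwards [hL.abs.eventually (lt_mem_nhds (half_lt_self hpos)), eventually_ge_atTop t₀]
      with t h1 ht
    have h2 := h.sq_velocity_le ht
    have h3 : |ψ t ^ 3| ≤ B * ψ t ^ 2 := by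
      rw [abs_pow, pow_succ', sq_abs]
      exact mul_le_mul_of_nonneg_right (hψ t ht) (sq_nonneg _)
    have h4 : |L| / 2 / B ≤ (n - 1) * D t := by
      rw [div_le_iff₀ hB]
      nlinarith
    rw [neg_le_neg_iff, div_le_iff₀ (by linarith)]
    linarith
  rw [hL0] at hL
  rw [Metric.tendsto_atTop]
  intro ε hε
  obtain ⟨N, hN⟩ := Metric.tendsto_atTop.1 hL (ε ^ 3) (by positivity)
  refine ⟨N, fun t ht => ?_⟩
  have h1 := hN t ht
  rw [Real.dist_0_eq_abs, abs_pow] at h1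
  rw [Real.dist_0_eq_abs]
  exact lt_of_pow_lt_pow_left₀ 3 hε.le h1

/-- The energy ψ²/2 + v has derivative -nHψ² + ψq, at most BκD; so it converges, and ψ → 0 leaves v.
-/
lemma exists_tendsto_potential (h : ReducedSystem n κ t₀ H D φ ψ v w q) {K : ℝ}
    (hw : ∀ t ∈ Ici t₀, |w t| ≤ K) : ∃ L, Tendsto v atTop (𝓝 L) := by
  have hn := h.one_lt
  obtain ⟨B, hB, hψ⟩ := h.exists_velocity_le
  obtain ⟨L, hL⟩ : ∃ L, Tendsto (fun t => 1 / 2 * ψ t ^ 2 + v t) atTop (𝓝 L) := by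
    refine exists_tendsto_of_deriv_le (M := B * κ) (b := 0)
      (fun t ht => (((h.deriv_velocity t ht).pow 2).const_mul (1 / 2)).add (h.deriv_potential t ht))
      h.deriv_hubble (mul_nonneg hB.le h.kappa_nonneg) h.decay_nonneg ?_
      (fun t ht => (h.pos t ht).le) (fun t ht => ?_)
    · intro t ht
      have h1 : ψ t * q t ≤ B * (κ * D t) :=
        (le_abs_self _).trans (by
          rw [abs_mul]
          exact mul_le_mul (hψ t ht) (h.matter_le t ht) (abs_nonneg _) hB.le)
      have h2 : 0 ≤ n * H t * ψ t ^ 2 :=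
        mul_nonneg (mul_nonneg (by linarith) (h.pos t ht).le) (sq_nonneg _)
      norm_num
      linarith
    · have := h.potential_pos t ht
      positivity
  have h1 := hL.sub (((h.tendsto_velocity hw).pow 2).const_mul (1 / 2))
  exact ⟨_, h1.congr fun t => by ring⟩

/-- The derivative of 1/H is D/H² ≤ n. The bound shows that H is not integrable at infinity. -/
lemma inv_hubble_le (h : ReducedSystem n κ t₀ H D φ ψ v w q) {t : ℝ} (ht : t ∈ Ici t₀) :
    (H t)⁻¹ ≤ n * (t - t₀) + (H t₀)⁻¹ := by
  have h1 : AntitoneOn (fun t => (H t)⁻¹ - n * t) (Ici t₀) :=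
    antitoneOn_Ici (f' := fun t => -(-D t) / H t ^ 2 - n * 1)
      (fun t ht => ((h.deriv_hubble t ht).inv (h.pos t ht).ne').sub
        ((hasDerivWithinAt_id t _).const_mul n)) fun t ht => by
        have h2 : D t / H t ^ 2 ≤ n := by
          rw [div_le_iff₀ (pow_pos (h.pos t ht) 2)]
          exact h.decay_le t ht
        simpa using h2
  have := h1 self_mem_Ici ht ht
  simp only at this
  linarith

/-- A quantity that decreases at the rate `ε H` as long as it exceeds `a` does not exceed `a` at
late times. -/
lemma eventually_le_of_deriv_le (h : ReducedSystem n κ t₀ H D φ ψ v w q) {f f' : ℝ → ℝ}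
    {t₁ a b ε : ℝ} (ht₁ : t₀ ≤ t₁) (hε : 0 < ε)
    (hf : ∀ t ∈ Ici t₁, HasDerivWithinAt f (f' t) (Ici t₁) t)
    (hb : ∀ t ∈ Ici t₁, b ≤ f t) (hf' : ∀ t ∈ Ici t₁, a ≤ f t → f' t ≤ -(ε * H t)) :
    ∀ᶠ t in atTop, f t ≤ a := by
  have hn : 0 < n := by linarith [h.one_lt]
  obtain ⟨t₂, ht₂, hft₂⟩ : ∃ t ∈ Ici t₁, f t ≤ a := by
    -- If f stayed above a, then f plus (ε/n) log(n(t - t₀) + c), whose second term has derivative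
    -- at most εH, would be antitone; the logarithm would then push f below b.
    by_contra! hno
    set c := (H t₀)⁻¹ with hc
    have hc0 : 0 < c := inv_pos.2 h.hubble_pos
    have hl : ∀ t ∈ Ici t₁, 0 < n * (t - t₀) + c := fun t ht => by
      have : 0 ≤ t - t₀ := sub_nonneg.2 (ht₁.trans ht)
      positivity
    have hd : ∀ t ∈ Ici t₁, HasDerivWithinAt (fun t => f t + ε / n * Real.log (n * (t - t₀) + c))
        (f' t + ε / n * ((n * 1) / (n * (t - t₀) + c))) (Ici t₁) t := fun t ht =>
      (hf t ht).add ((((((hasDerivWithinAt_id t _).sub_const t₀).const_mul n).add_const c).log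
        (hl t ht).ne').const_mul _)
    have h1 : AntitoneOn (fun t => f t + ε / n * Real.log (n * (t - t₀) + c)) (Ici t₁) := by
      refine antitoneOn_Ici hd fun t ht => ?_
      have ht0 : t ∈ Ici t₀ := ht₁.trans ht
      have h2 := hf' t ht (hno t ht).le
      have h3 : (n * (t - t₀) + c)⁻¹ ≤ H t := inv_le_of_inv_le₀ (h.pos t ht0) (h.inv_hubble_le ht0)
      have h4 : ε / n * ((n * 1) / (n * (t - t₀) + c)) = ε * (n * (t - t₀) + c)⁻¹ := by
        field_simp
      rw [h4]
      linarith [mul_le_mul_of_nonneg_left h3 hε.le]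
    have hlim : Tendsto (fun t => ε / n * Real.log (n * (t - t₀) + c)) atTop atTop := by
      refine Tendsto.const_mul_atTop (by positivity) (Real.tendsto_log_atTop.comp ?_)
      exact tendsto_atTop_add_const_right _ _ (Tendsto.const_mul_atTop hn
        (tendsto_atTop_add_const_right _ (-t₀) tendsto_id))
    obtain ⟨t, ht, hlt⟩ := ((eventually_ge_atTop t₁).and (hlim.eventually_gt_atTop
      (f t₁ + ε / n * Real.log (n * (t₁ - t₀) + c) - b))).exists
    have := h1 self_mem_Ici ht ht
    simp only at this
    linarith [hb t ht]
  filter_upwards [eventually_ge_atTop t₂] with t ht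
  have hsub : ∀ s ∈ Icc t₂ t, s ∈ Ici t₁ := fun s hs => ht₂.trans hs.1
  -- Once below the level a, f cannot cross it, because its derivative is strictly negative wherever
  -- f = a.
  refine image_le_of_deriv_right_lt_deriv_boundary' (f := f) (f' := f') (B := fun _ => a)
    (B' := fun _ => 0) (a := t₂) (b := t) ?_ ?_ hft₂ continuousOn_const
    (fun s _ => hasDerivWithinAt_const _ _ _) ?_ ⟨ht, le_rfl⟩
  · exact fun s hs => (hf s (hsub s hs)).continuousWithinAt.mono fun r hr => hsub r hr
  · exact fun s hs => (hf s (hsub s (Ico_subset_Icc_self hs))).mono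
      (Ici_subset_Ici.2 (hsub s (Ico_subset_Icc_self hs)))
  · intro s hs hfs
    have hs1 := hsub s (Ico_subset_Icc_self hs)
    have := mul_pos hε (h.pos s (ht₁.trans hs1))
    linarith [hf' s hs1 hfs.ge]

/-- If `|V'| ≤ β V` along the solution at late times, then `1 - 1 / W` is at most `n β² / 16` in
the limit. -/
lemma eventually_ratio_ge (h : ReducedSystem n κ t₀ H D φ ψ v w q) {β y : ℝ}
    (hβ : ∀ᶠ t in atTop, |w t| ≤ β * v t) (hy : n * β ^ 2 / 16 < y) (hy1 : y < 1) :
    ∀ᶠ t in atTop, n * (n - 1) * H t ^ 2 / (2 * v t) ≤ (1 - y)⁻¹ := by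
  have hn : 0 < n := by linarith [h.one_lt]
  have hc := h.coeff_pos
  obtain ⟨t₁', ht₁'⟩ := eventually_atTop.1 hβ
  set t₁ := max t₁' t₀
  have ht₁ : t₀ ≤ t₁ := le_max_right _ _
  have hsub : Ici t₁ ⊆ Ici t₀ := Ici_subset_Ici.2 ht₁
  set W : ℝ → ℝ := fun t => n * (n - 1) * H t ^ 2 / (2 * v t) with hW
  have hW1 : ∀ t ∈ Ici t₀, 1 ≤ W t := fun t ht => by
    have hv := h.potential_pos t ht
    rw [hW]
    simp only
    rw [one_le_div (by positivity)]
    linarith [h.energy_le t ht, sq_nonneg (ψ t)]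
  have hlogW : ∀ t ∈ Ici t₀, Real.log (W t)
      = Real.log (n * (n - 1) / 2) + 2 * Real.log (H t) - Real.log (v t) := fun t ht => by
    have hv := h.potential_pos t ht
    have hH := h.pos t ht
    have h1 : W t = n * (n - 1) / 2 * H t ^ 2 / v t := by
      rw [hW]
      simp only
      field_simp
    rw [h1, Real.log_div (by positivity) hv.ne', Real.log_mul (by positivity) (by positivity),
      Real.log_pow]
    norm_num
  have hderiv : ∀ t ∈ Ici t₁, HasDerivWithinAt
      (fun t => Real.log (n * (n - 1) / 2) + 2 * Real.log (H t) - Real.log (v t))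
      (2 * (-D t / H t) - w t * ψ t / v t) (Ici t₁) t := fun t ht =>
    (((((h.deriv_hubble t (hsub ht)).mono hsub).log (h.pos t (hsub ht)).ne').const_mul
      2).const_add _).sub
      (((h.deriv_potential t (hsub ht)).mono hsub).log (h.potential_pos t (hsub ht)).ne')
  have key : ∀ᶠ t in atTop,
      Real.log (n * (n - 1) / 2) + 2 * Real.log (H t) - Real.log (v t) ≤ Real.log (1 - y)⁻¹ := by
    -- The lower bound 0 for log W comes from W ≥ 1; ε is what remains of the damping 2yH after β|ψ|
    -- has been absorbed.
    refine h.eventually_le_of_deriv_le (b := 0) (ε := 2 * (y - n * β ^ 2 / 16)) ht₁ (by linarith)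
      hderiv (fun t ht => ?_) fun t ht hle => ?_
    · rw [← hlogW t (hsub ht)]
      exact Real.log_nonneg (hW1 t (hsub ht))
    · have hv := h.potential_pos t (hsub ht)
      have hH := h.pos t (hsub ht)
      rw [← hlogW t (hsub ht), Real.log_le_log_iff (inv_pos.2 (by linarith))
        (by linarith [hW1 t (hsub ht)]), hW] at hle
      simp only at hle
      rw [inv_le_iff_one_le_mul₀ (by linarith), div_mul_eq_mul_div, one_le_div (by positivity)]
        at hle
      have h1 := h.le_decay t (hsub ht)
      -- Here `hle` reads 2v ≤ (1 - y) n(n-1)H², so the bracket in `le_decay` is at least y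
      -- n(n-1)H².
      have h2 : n * (n - 1) * (ψ t ^ 2 / n + y * H t ^ 2) ≤ n * (n - 1) * D t := by
        have : n * (n - 1) * (ψ t ^ 2 / n + y * H t ^ 2)
            = (n - 1) * ψ t ^ 2 + n * (n - 1) * y * H t ^ 2 := by
          field_simp
        rw [this]
        linarith
      have h3 := le_of_mul_le_mul_left h2 hc
      have h4 : -(w t * ψ t / v t) ≤ β * |ψ t| := by
        rw [← neg_div, div_le_iff₀ hv]
        have h5 : -(w t * ψ t) ≤ |w t| * |ψ t| := by
          rw [← abs_mul]
          exact neg_le_abs _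
        have h6 := mul_le_mul_of_nonneg_right (ht₁' t ((le_max_left _ _).trans ht))
          (abs_nonneg (ψ t))
        linarith
      have h7 : (ψ t ^ 2 / n + y * H t ^ 2) / H t ≤ D t / H t := by gcongr
      -- Completing the square in |ψ|: the potential's contribution is absorbed by the kinetic part
      -- of 2D/H at the cost nβ²H/8.
      have h8 : β * |ψ t| ≤ 2 * (ψ t ^ 2 / n / H t) + n * H t * β ^ 2 / 8 := by
        have h9 : 2 * (ψ t ^ 2 / n / H t) + n * H t * β ^ 2 / 8 - β * |ψ t|
            = 2 * (|ψ t| - n * H t * β / 4) ^ 2 / (n * H t) := by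
          rw [← sq_abs (ψ t)]
          field_simp
          ring
        have : 0 ≤ 2 * (|ψ t| - n * H t * β / 4) ^ 2 / (n * H t) := by positivity
        linarith
      have h10 : (ψ t ^ 2 / n + y * H t ^ 2) / H t = ψ t ^ 2 / n / H t + y * H t := by
        field_simp
      have h11 : -D t / H t = -(D t / H t) := neg_div _ _
      rw [h11]
      linarith
  filter_upwards [key, eventually_ge_atTop t₀] with t ht ht0
  rw [← hlogW t ht0, Real.log_le_log_iff (by linarith [hW1 t ht0]) (inv_pos.2 (by linarith))] at ht
  exact ht

end ReducedSystem

end Evolution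

/-! ### From the field equations to the reduced system. -/

section Reduction

variable {n : ℕ}

lemma metricTrace_add (P A B : Matrix (Fin n) (Fin n) ℝ) :
    metricTrace P (A + B) = metricTrace P A + metricTrace P B := by
  simp [metricTrace, mul_add, Finset.sum_add_distrib]

lemma metricTrace_smul (P A : Matrix (Fin n) (Fin n) ℝ) (r : ℝ) :
    metricTrace P (r • A) = r * metricTrace P A := by
  simp only [metricTrace, Matrix.smul_apply, smul_eq_mul, Finset.mul_sum]
  exact Finset.sum_congr rfl fun i _ => Finset.sum_congr rfl fun j _ => by ring

lemma metricTrace_sub (P A B : Matrix (Fin n) (Fin n) ℝ) :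
    metricTrace P (A - B) = metricTrace P A - metricTrace P B := by
  simp [metricTrace, mul_sub, Finset.sum_sub_distrib]

lemma metricTrace_self {P : Matrix (Fin n) (Fin n) ℝ} (hP : P.PosDef) : metricTrace P P = n := by
  rw [metricTrace_eq_trace hP.isSymm, Matrix.nonsing_inv_mul _
    ((Matrix.isUnit_iff_isUnit_det _).1 hP.isUnit)]
  simp

variable {sc : Fin n → Fin n → Fin n → ℝ} {I J : Set ℝ} {γ : ℝ → Matrix (Fin n) (Fin n) ℝ}
  {V C c ρ φ : ℝ → ℝ} {j : ℝ → Fin n → ℝ} {S : ℝ → Matrix (Fin n) (Fin n) ℝ} {t : ℝ}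

lemma hubble_eq (h : MetricFamily I γ) (ht : t ∈ I) :
    hubble I γ t = (mixedExpansion I γ t).trace / n := by
  have h1 : secondForm I γ t = (-1 : ℝ) • expansion I γ t := by
    ext i j
    simp [secondForm, expansion]
  rw [hubble, h1, metricTrace_smul, metricTrace_eq_trace (h.isSymm_expansion ht), mixedExpansion]
  ring

lemma metricTrace_gradientSq (h : (γ t).PosDef) :
    metricTrace (spacetimeMetric γ t) (gradientSq I spacetimeDir φ t)
      = -derivWithin φ I t ^ 2 := by
  rw [metricTrace_spacetime h]
  simp [gradientSq, gradient, metricTrace, Matrix.toBlocks₂₂, sq]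

lemma metricTrace_energyMomentum (h : (γ t).PosDef) :
    metricTrace (spacetimeMetric γ t) (energyMomentum ρ j S t)
      = -ρ t + metricTrace (γ t) (S t) := by
  rw [metricTrace_spacetime h]
  simp [energyMomentum]

lemma box_eq (h : MetricFamily I γ) (ht : t ∈ I) :
    box I (spacetimeConstants sc) spacetimeDir (spacetimeMetric γ) φ t
      = -derivWithin (derivWithin φ I) I t
        - (mixedExpansion I γ t).trace * derivWithin φ I t := by
  have hp := h.posDef t ht
  have h1 : frameDeriv I (spacetimeDir (n := n)) (Sum.inl ()) φ = derivWithin φ I := by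
    ext s
    simp
  have h2 : (hessian I (spacetimeConstants sc) spacetimeDir (spacetimeMetric γ) φ t).toBlocks₂₂
      = (-derivWithin φ I t) • expansion I γ t := by
    ext a b
    simp [hessian, Matrix.toBlocks₂₂, Fintype.sum_sum_type, christoffel_inl_inr_inr hp, mul_comm]
  rw [box, metricTrace_spacetime hp, h2, metricTrace_smul,
    metricTrace_eq_trace (h.isSymm_expansion ht), ← mixedExpansion]
  simp [hessian, Fintype.sum_sum_type, christoffel_inl_inl_inl hp, h1]
  ring

/-- The Hamiltonian constraint. -/
lemma SolvesESM.constraint (hsol : SolvesESM sc I J V C c γ ρ j S φ) (h : MetricFamily I γ)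
    (ht : t ∈ I) :
    (mixedExpansion I γ t).trace ^ 2 - (mixedExpansion I γ t * mixedExpansion I γ t).trace
        + leftInvariantScalar sc (γ t)
      = derivWithin φ I t ^ 2 + 2 * V (φ t) + 2 * (C (φ t) * ρ t) := by
  have hp := h.posDef t ht
  have h1 := congrFun (congrFun (hsol.einstein t ht) (Sum.inl ())) (Sum.inl ())
  -- The scalar curvature is the spatial trace of Ricci minus its time-time component, so the
  -- derivative of the trace cancels and a constraint without second derivatives remains.
  rw [metricTrace_gradientSq hp, scalar, metricTrace_spacetime hp, h.metricTrace_ricci ht] at h1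
  simp [h.ricci_inl_inl ht, gradientSq, gradient, energyMomentum] at h1
  linarith

/-- The trace of the spatial part of Einstein's equations. -/
lemma SolvesESM.evolution (hsol : SolvesESM sc I J V C c γ ρ j S φ) (h : MetricFamily I γ)
    (ht : t ∈ I) :
    (leftInvariantScalar sc (γ t) + derivWithin (fun s => (mixedExpansion I γ s).trace) I t
        + (mixedExpansion I γ t).trace ^ 2) * (1 - n / 2)
      - (derivWithin (fun s => (mixedExpansion I γ s).trace) I t
        + (mixedExpansion I γ t * mixedExpansion I γ t).trace) * (n / 2)
      = n / 2 * derivWithin φ I t ^ 2 - n * V (φ t) + C (φ t) * metricTrace (γ t) (S t) := by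
  have hp := h.posDef t ht
  have h1 := congrArg (fun B => metricTrace (γ t) B.toBlocks₂₂) (hsol.einstein t ht)
  rw [metricTrace_gradientSq hp, scalar, metricTrace_spacetime hp, h.metricTrace_ricci ht,
    h.ricci_inl_inl ht] at h1
  have hsub : ∀ A B : Matrix (Unit ⊕ Fin n) (Unit ⊕ Fin n) ℝ,
      (A - B).toBlocks₂₂ = A.toBlocks₂₂ - B.toBlocks₂₂ := fun _ _ => rfl
  have hadd : ∀ A B : Matrix (Unit ⊕ Fin n) (Unit ⊕ Fin n) ℝ,
      (A + B).toBlocks₂₂ = A.toBlocks₂₂ + B.toBlocks₂₂ := fun _ _ => rfl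
  have hsmul : ∀ (r : ℝ) (A : Matrix (Unit ⊕ Fin n) (Unit ⊕ Fin n) ℝ),
      (r • A).toBlocks₂₂ = r • A.toBlocks₂₂ := fun _ _ => rfl
  have hg : (spacetimeMetric γ t).toBlocks₂₂ = γ t := rfl
  have hS : (energyMomentum ρ j S t).toBlocks₂₂ = S t := rfl
  have hφ : (gradientSq I (spacetimeDir (n := n)) φ t).toBlocks₂₂ = 0 := by
    ext a b
    simp [gradientSq, gradient, Matrix.toBlocks₂₂]
  have h0 : metricTrace (γ t) (0 : Matrix (Fin n) (Fin n) ℝ) = 0 := by simp [metricTrace]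
  simp only [hsub, hadd, hsmul, hg, hS, hφ, h0, metricTrace_sub, metricTrace_add,
    metricTrace_smul, metricTrace_self hp, h.metricTrace_ricci ht] at h1
  linarith

/-- The equations of motion of coupled quintessence imply the reduced system for the mean
curvature and the scalar field. -/
lemma SolvesESM.exists_reducedSystem (hn : 3 ≤ n) {t₀ : ℝ}
    (hscal : ∀ P : Matrix (Fin n) (Fin n) ℝ, P.PosDef → leftInvariantScalar sc P ≤ 0)
    (hV : AdmissiblePotential J V) (hC : AdmissibleCoupling J C c)
    (hreg : RegularData (Ici t₀) J γ ρ j S φ)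
    (hsol : SolvesESM sc (Ici t₀) J V C c γ ρ j S φ)
    (hmatter : EnergyConditions (Ici t₀) γ ρ j S)
    (hexp : 0 < hubble (Ici t₀) γ t₀) :
    ∃ (κ : ℝ) (D q : ℝ → ℝ), ReducedSystem n κ t₀ (hubble (Ici t₀) γ) D φ
      (derivWithin φ (Ici t₀)) (fun t => V (φ t)) (fun t => derivWithin V J (φ t)) q := by
  have h : MetricFamily (Ici t₀) γ :=
    ⟨uniqueDiffOn_Ici t₀, hreg.metric_posDef, hreg.metric_smooth⟩
  have hn' : (3 : ℝ) ≤ n := by exact_mod_cast hn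
  have hn0 : (0 : ℝ) < n := by linarith
  obtain ⟨C₀, hC₀⟩ := hC.bound
  have hH : ∀ t ∈ Ici t₀, HasDerivWithinAt (hubble (Ici t₀) γ)
      (derivWithin (fun s => (mixedExpansion (Ici t₀) γ s).trace) (Ici t₀) t / n) (Ici t₀) t := by
    intro t ht
    have h1 : DifferentiableWithinAt ℝ (fun s => (mixedExpansion (Ici t₀) γ s).trace)
        (Ici t₀) t := by
      simp only [Matrix.trace, Matrix.diag]
      exact DifferentiableWithinAt.fun_sum fun i _ => h.differentiable_mixedExpansion ht i i
    exact (h1.hasDerivWithinAt.div_const (n : ℝ)).congr_of_mem (fun s hs => hubble_eq h hs) ht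
  have hφ : ∀ t ∈ Ici t₀, HasDerivWithinAt φ (derivWithin φ (Ici t₀) t) (Ici t₀) t := fun t ht =>
    (hreg.field_smooth.differentiableOn (by norm_num) t ht).hasDerivWithinAt
  have hρ : ∀ t ∈ Ici t₀, 0 ≤ C (φ t) * ρ t := fun t ht =>
    mul_nonneg (hC.nonneg _ (hreg.field_mem ht)) ((Real.sqrt_nonneg _).trans (hmatter.flux_le t ht))
  have hstrong : ∀ t ∈ Ici t₀, 0 ≤ C (φ t) * ρ t + C (φ t) * metricTrace (γ t) (S t) :=
    fun t ht => by
      rw [← mul_add]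
      exact mul_nonneg (hC.nonneg _ (hreg.field_mem ht)) (hmatter.strong t ht)
  have hstress : ∀ t ∈ Ici t₀, C (φ t) * metricTrace (γ t) (S t) ≤ n * (C (φ t) * ρ t) :=
    fun t ht => by
      have := mul_le_mul_of_nonneg_left ((le_abs_self _).trans (hmatter.stress_le t ht))
        (hC.nonneg _ (hreg.field_mem ht))
      linarith
  -- The factor n + 1 comes from |tr T| ≤ (n + 1)ρ, the factor n from C(φ)ρ ≤ nD.
  refine ⟨|C₀| * (n + 1) * n,
    fun t => -(derivWithin (fun s => (mixedExpansion (Ici t₀) γ s).trace) (Ici t₀) t / n),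
    fun t => c (φ t) * metricTrace (spacetimeMetric γ t) (energyMomentum ρ j S t),
    by linarith, by positivity, fun t ht => by simpa only [neg_neg] using hH t ht, hφ, ?_, ?_,
    fun t ht => hV.pos _ (hreg.field_mem ht), ?_, ?_, ?_, ?_, hexp⟩
  · intro t ht
    have h1 : ContDiffOn ℝ 1 (derivWithin φ (Ici t₀)) (Ici t₀) :=
      hreg.field_smooth.derivWithin (uniqueDiffOn_Ici t₀) (by norm_num)
    have h2 := (h1.differentiableOn (by norm_num) t ht).hasDerivWithinAt
    have h3 := hsol.scalar_field t ht
    rw [box_eq h ht] at h3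
    refine h2.congr_deriv ?_
    rw [hubble_eq h ht]
    field_simp
    linarith
  · intro t ht
    exact (hV.smooth.differentiableOn (by norm_num) (φ t)
      (hreg.field_mem ht)).hasDerivWithinAt.comp t (hφ t ht) hreg.field_mem
  all_goals intro t ht
  all_goals
    have h1 := hsol.constraint h ht
    have h2 := hsol.evolution h ht
    have h3 := h.trace_sq_le ht
    have h4 := hscal _ (hreg.metric_posDef t ht)
    have h5 := hρ t ht
    have h6 := hstrong t ht
    have h7 := hstress t ht
    have h0 := hubble_eq h ht
    set θ := (mixedExpansion (Ici t₀) γ t).trace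
    set θ' := derivWithin (fun s => (mixedExpansion (Ici t₀) γ s).trace) (Ici t₀) t
    set k := (mixedExpansion (Ici t₀) γ t * mixedExpansion (Ici t₀) γ t).trace
    set ψ := derivWithin φ (Ici t₀) t
    set r := leftInvariantScalar sc (γ t)
    set m := C (φ t) * ρ t with hm
    set p := C (φ t) * metricTrace (γ t) (S t)
    -- The squared norm of the trace-free part of the expansion (the shear).
    obtain ⟨s, hs⟩ : ∃ s, s = k - θ ^ 2 / n := ⟨_, rfl⟩
    have hs0 : 0 ≤ s := by
      rw [hs, sub_nonneg, div_le_iff₀ hn0]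
      linarith
    have hk : k = s + θ ^ 2 / n := by linarith
    have hθ : (n : ℝ) * (n - 1) * (θ / n) ^ 2 = s - r + ψ ^ 2 + 2 * V (φ t) + 2 * m := by
      have : (n : ℝ) * (n - 1) * (θ / n) ^ 2 = θ ^ 2 - θ ^ 2 / n := by
        field_simp
      linarith
    have hθ' : (n : ℝ) * (n - 1) * (-(θ' / n)) = n * s - r + n * ψ ^ 2 + n * m + p := by
      have : (n : ℝ) * (n - 1) * (-(θ' / n)) = -(n - 1) * θ' := by
        field_simp
      rw [this]
      have h8 : (n : ℝ) * k = n * s + θ ^ 2 := by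
        rw [hk]
        field_simp
      -- Adding n/2 times the constraint to the evolution equation eliminates V.
      linear_combination h2 + (n / 2 : ℝ) * h1 + h8
  · rw [h0]
    linarith
  · rw [h0, hθ, hθ']
    -- The difference of the two sides is (n-1)s + (n-3)m + (m+p); this is where n ≥ 3 and the
    -- strong energy condition enter.
    have := mul_nonneg (sub_nonneg.2 hn') hs0
    have := mul_nonneg (sub_nonneg.2 hn') h5
    nlinarith
  · rw [h0]
    -- The difference of the two sides is -(n-1)r + 2nV + (nm - p), and each summand is
    -- non-negative.
    have h8 : (n : ℝ) * (n - 1) * (-(θ' / n)) ≤ n * (n - 1) * (n * (θ / n) ^ 2) := by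
      have : (n : ℝ) * (n - 1) * (n * (θ / n) ^ 2) = n * (n * (n - 1) * (θ / n) ^ 2) := by ring
      rw [this, hθ, hθ']
      have := mul_pos hn0 (hV.pos _ (hreg.field_mem ht))
      nlinarith
    exact le_of_mul_le_mul_left h8 (mul_pos hn0 (by linarith))
  · have h8 : m ≤ n * (-(θ' / n)) := by
      have h9 : ((n : ℝ) - 1) * m ≤ (n - 1) * (n * (-(θ' / n))) := by
        have : ((n : ℝ) - 1) * (n * (-(θ' / n))) = n * (n - 1) * (-(θ' / n)) := by ring
        rw [this, hθ']
        nlinarith [mul_nonneg hn0.le hs0, mul_nonneg hn0.le (sq_nonneg ψ)]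
      exact le_of_mul_le_mul_left h9 (by linarith)
    have h10 : |c (φ t) * metricTrace (spacetimeMetric γ t) (energyMomentum ρ j S t)|
        ≤ |C₀| * (n + 1) * m := by
      rw [metricTrace_energyMomentum (hreg.metric_posDef t ht), abs_mul]
      have hρ0 : 0 ≤ ρ t := (Real.sqrt_nonneg _).trans (hmatter.flux_le t ht)
      have h11 : |-ρ t + metricTrace (γ t) (S t)| ≤ (n + 1) * ρ t := by
        refine (abs_add_le _ _).trans ?_
        rw [abs_neg, abs_of_nonneg hρ0]
        linarith [hmatter.stress_le t ht]
      have h12 : |c (φ t)| ≤ |C₀| * C (φ t) := (hC₀ _ (hreg.field_mem ht)).trans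
        (mul_le_mul_of_nonneg_right (le_abs_self _) (hC.nonneg _ (hreg.field_mem ht)))
      calc _ ≤ |C₀| * C (φ t) * ((n + 1) * ρ t) :=
            mul_le_mul h12 h11 (abs_nonneg _) ((abs_nonneg _).trans h12)
        _ = _ := by rw [hm]; ring
    refine h10.trans ?_
    rw [mul_assoc (|C₀| * ((n : ℝ) + 1))]
    exact mul_le_mul_of_nonneg_left h8 (by positivity)

end Reduction

/-! ### Behaviour of the field when the potential energy tends to zero. -/

section Asymptotics

/-- A positive continuous function on `[t₀, ∞)` with infimum zero that converges tends to zero. -/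
lemma tendsto_zero_of_sInf_eq_zero {t₀ L : ℝ} {v : ℝ → ℝ} (hv : ContinuousOn v (Ici t₀))
    (hpos : ∀ t ∈ Ici t₀, 0 < v t) (hinf : sInf (v '' Ici t₀) = 0) (hL : Tendsto v atTop (𝓝 L)) :
    Tendsto v atTop (𝓝 0) := by
  have hL0 : 0 ≤ L := ge_of_tendsto hL (by
    filter_upwards [eventually_ge_atTop t₀] with t ht using (hpos t ht).le)
  rcases hL0.eq_or_lt with rfl | hlt
  · exact hL
  exfalso
  obtain ⟨T, hT⟩ := eventually_atTop.1 (hL.eventually (lt_mem_nhds (half_lt_self hlt)))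
  obtain ⟨a, ha, hmin⟩ := (isCompact_Icc (a := t₀) (b := max t₀ T)).exists_isMinOn
    (nonempty_Icc.2 (le_max_left _ _)) (hv.mono Icc_subset_Ici_self)
  -- A positive limit would bound v below by L/2 at late times and by a positive minimum on the
  -- remaining compact interval.
  have h1 : min (v a) (L / 2) ≤ sInf (v '' Ici t₀) := by
    refine le_csInf (nonempty_Ici.image v) ?_
    rintro _ ⟨t, ht, rfl⟩
    rcases le_total t (max t₀ T) with hle | hle
    · exact (min_le_left _ _).trans (hmin ⟨ht, hle⟩)
    · exact (min_le_right _ _).trans (hT t ((le_max_right _ _).trans hle)).le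
  rw [hinf] at h1
  exact absurd h1 (not_le.2 (lt_min (hpos a ha.1) (half_pos hlt)))

/-- If the potential energy tends to zero, then the field leaves every bounded set. -/
lemma AdmissiblePotential.tendsto_abs {J : Set ℝ} {V : ℝ → ℝ} (hV : AdmissiblePotential J V)
    {φ : ℝ → ℝ} {t₀ : ℝ} (hφ : MapsTo φ (Ici t₀) J)
    (h0 : Tendsto (fun t => V (φ t)) atTop (𝓝 0)) : Tendsto (fun t => |φ t|) atTop atTop := by
  obtain ⟨U, hU, hUpos, hUV⟩ := hV.minorant
  rw [tendsto_atTop]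
  intro R
  have hK : IsCompact (closure J ∩ Icc (-R) R) := isCompact_Icc.inter_left isClosed_closure
  rcases (closure J ∩ Icc (-R) R).eq_empty_or_nonempty with he | hne
  · filter_upwards [eventually_ge_atTop t₀] with t ht
    by_contra! hlt
    exact (Set.eq_empty_iff_forall_notMem.1 he) (φ t)
      ⟨subset_closure (hφ ht), abs_le.1 hlt.le⟩
  · obtain ⟨a, ha, hmin⟩ := (hU.mono inter_subset_left).exists_isMinOn hne hK
    filter_upwards [eventually_ge_atTop t₀, h0.eventually (gt_mem_nhds (hUpos a ha.1))] with t ht hlt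
    by_contra! hlt'
    have h1 : U a ≤ U (φ t) := hmin ⟨subset_closure (hφ ht), abs_le.1 hlt'.le⟩
    linarith [hUV _ (hφ ht)]

lemma tendsto_atTop_or_atBot {t₀ : ℝ} {φ : ℝ → ℝ} (hφ : ContinuousOn φ (Ici t₀))
    (h : Tendsto (fun t => |φ t|) atTop atTop) :
    Tendsto φ atTop atTop ∨ Tendsto φ atTop atBot := by
  obtain ⟨T', hT'⟩ := eventually_atTop.1 (h.eventually_gt_atTop 0)
  set T := max t₀ T'
  have hne : ∀ t ∈ Ici T, φ t ≠ 0 := fun t ht =>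
    abs_pos.1 (hT' t ((le_max_right _ _).trans ht))
  have hc : ContinuousOn φ (Ici T) := hφ.mono (Ici_subset_Ici.2 (le_max_left _ _))
  have hsign : (∀ t ∈ Ici T, 0 < φ t) ∨ ∀ t ∈ Ici T, φ t < 0 := by
    by_contra! hcon
    obtain ⟨⟨a, ha, ha0⟩, b, hb, hb0⟩ := hcon
    obtain ⟨t, ht, ht0⟩ := isPreconnected_Ici.intermediate_value ha hb hc ⟨ha0, hb0⟩
    exact hne t ht ht0
  rcases hsign with hs | hs
  · refine Or.inl (h.congr' ?_)
    filter_upwards [eventually_ge_atTop T] with t ht using abs_of_pos (hs t ht)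
  · refine Or.inr ((tendsto_neg_atTop_atBot.comp h).congr' ?_)
    filter_upwards [eventually_ge_atTop T] with t ht
    simp [abs_of_neg (hs t ht)]

/-- Compares the bound of `eventually_ratio_ge` with the claimed one. For α > 0, dividing the first
inequality by α makes it linear, and at the largest admissible α it amounts to n ≤ 4(n-1). -/
lemma sq_steepness_le {n : ℕ} (hn : 3 ≤ n) {α : ℝ} (h0 : 0 ≤ α)
    (hα : α < 2 / √((n : ℝ) * (n - 1))) :
    n * α ^ 2 / 16 ≤ 1 / 2 * √(((n : ℝ) - 1) / n) * α ∧ 1 / 2 * √(((n : ℝ) - 1) / n) * α < 1 := by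
  have hn' : (3 : ℝ) ≤ n := by exact_mod_cast hn
  have hn1 : (0 : ℝ) ≤ n - 1 := by linarith
  rw [Real.sqrt_mul (by linarith)] at hα
  rw [Real.sqrt_div hn1]
  have ha := Real.sq_sqrt (show (0 : ℝ) ≤ n by linarith)
  have hb := Real.sq_sqrt hn1
  have ha0 : 0 < √(n : ℝ) := Real.sqrt_pos.2 (by linarith)
  have hb0 : 0 < √((n : ℝ) - 1) := Real.sqrt_pos.2 (by linarith)
  set a := √(n : ℝ)
  set b := √((n : ℝ) - 1)
  have h1 : α * (a * b) < 2 := (lt_div_iff₀ (by positivity)).1 hα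
  constructor
  · have h2 : a ^ 2 * α / 16 ≤ 1 / 2 * (b / a) := by
      have h3 : a ^ 2 * α / 16 ≤ a / (8 * b) := by
        rw [le_div_iff₀ (by positivity)]
        nlinarith
      refine h3.trans ?_
      rw [mul_div_assoc', div_le_div_iff₀ (by positivity) ha0]
      nlinarith
    have h4 := mul_le_mul_of_nonneg_right h2 h0
    rw [ha] at h4
    linarith
  · have h5 : 1 / 2 * (b / a) * α = α * (a * b) / (2 * a ^ 2) := by
      field_simp
    rw [h5, div_lt_one (by positivity)]
    nlinarith

/-- The steepness of the potential controls its logarithmic derivative along the field. -/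
lemma eventually_deriv_le_of_steepness {J : Set ℝ} {V : ℝ → ℝ} (hV : AdmissiblePotential J V)
    {φ : ℝ → ℝ} {t₀ : ℝ} (hφ : MapsTo φ (Ici t₀) J) {l : Filter ℝ} (hl : Tendsto φ atTop l)
    {α : ℝ} (hα : steepness J V l = (α : EReal)) :
    0 ≤ α ∧ ∀ β > α, ∀ᶠ t in atTop, |derivWithin V J (φ t)| ≤ β * V (φ t) := by
  have hlJ : Tendsto φ atTop (l ⊓ 𝓟 J) := tendsto_inf.2 ⟨hl, tendsto_principal.2
    ((eventually_ge_atTop t₀).mono fun t ht => hφ ht)⟩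
  have hJ : ∀ᶠ x in l ⊓ 𝓟 J, x ∈ J := mem_inf_of_right (mem_principal_self J)
  have : (l ⊓ 𝓟 J).NeBot := hlJ.neBot
  constructor
  · have h1 : (0 : EReal) ≤ steepness J V l :=
      le_limsup_of_frequently_le (hJ.mono fun x hx => by
        exact_mod_cast div_nonneg (abs_nonneg _) (hV.pos x hx).le).frequently
    rw [hα] at h1
    exact_mod_cast h1
  · intro β hβ
    have h1 : steepness J V l < (β : EReal) := by
      rw [hα]
      exact_mod_cast hβ
    filter_upwards [hlJ.eventually (eventually_lt_of_limsup_lt h1), eventually_ge_atTop t₀]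
      with t ht ht0
    have h2 : |derivWithin V J (φ t)| / V (φ t) < β := by exact_mod_cast ht
    exact ((div_lt_iff₀ (hV.pos _ (hφ ht0))).1 h2).le

end Asymptotics

end Quintessence

end

/-! ### Conclusion. -/

theorem mainTheorem6 {n : ℕ} (hn : 3 ≤ n)
    {𝔤 : Type*} [LieRing 𝔤] [LieAlgebra ℝ 𝔤] (e : Module.Basis (Fin n) ℝ 𝔤)
    (hscal : ∀ P : Matrix (Fin n) (Fin n) ℝ, P.PosDef →
      Quintessence.leftInvariantScalar (Quintessence.structureConstants e) P ≤ 0)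
    (J : Set ℝ) (hJ : J.OrdConnected) (hJint : (interior J).Nonempty)
    (V C c : ℝ → ℝ)
    (hV : Quintessence.AdmissiblePotential J V)
    (hC : Quintessence.AdmissibleCoupling J C c)
    (t₀ : ℝ)
    (γ : ℝ → Matrix (Fin n) (Fin n) ℝ) (ρ : ℝ → ℝ) (j : ℝ → Fin n → ℝ)
    (S : ℝ → Matrix (Fin n) (Fin n) ℝ) (φ : ℝ → ℝ)
    (hreg : Quintessence.RegularData (Set.Ici t₀) J γ ρ j S φ)
    (hsol : Quintessence.SolvesESM (Quintessence.structureConstants e) (Set.Ici t₀) J V C c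
      γ ρ j S φ)
    (hmatter : Quintessence.EnergyConditions (Set.Ici t₀) γ ρ j S)
    (hexp : 0 < Quintessence.hubble (Set.Ici t₀) γ t₀)
    (hV₀ : sInf ((fun t => V (φ t)) '' Set.Ici t₀) = 0) :
    ∃ l : Filter ℝ, (l = Filter.atTop ∨ l = Filter.atBot) ∧
      Filter.Tendsto φ Filter.atTop l ∧
      ∀ α : ℝ, Quintessence.steepness J V l = (α : EReal) →
        α < 2 / √((n : ℝ) * (n - 1)) →
        Filter.limsup
            (fun t => ((Quintessence.wQuantity (Set.Ici t₀) V γ φ t : ℝ) : EReal)) Filter.atTop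
          ≤ (((1 - 1 / 2 * √(((n : ℝ) - 1) / n) * α)⁻¹ : ℝ) : EReal) := by
  obtain ⟨κ, D, q, sys⟩ := hsol.exists_reducedSystem hn hscal hV hC hreg hmatter hexp
  obtain ⟨K, hK⟩ := hV.deriv_bounded (φ '' Ici t₀) hreg.field_mem.image_subset
    ⟨n * (n - 1) * Quintessence.hubble (Ici t₀) γ t₀ ^ 2, by
      rintro _ ⟨t, ht, rfl⟩
      rw [abs_of_pos (hV.pos _ (hreg.field_mem ht))]
      exact sys.potential_le ht⟩
  obtain ⟨L, hL⟩ := sys.exists_tendsto_potential (K := K) fun t ht => hK _ (mem_image_of_mem φ ht)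
  have hv0 : Tendsto (fun t => V (φ t)) atTop (𝓝 0) :=
    Quintessence.tendsto_zero_of_sInf_eq_zero
      (fun t ht => (sys.deriv_potential t ht).continuousWithinAt) sys.potential_pos hV₀ hL
  obtain ⟨l, hl, hφl⟩ : ∃ l : Filter ℝ, (l = atTop ∨ l = atBot) ∧ Tendsto φ atTop l := by
    rcases Quintessence.tendsto_atTop_or_atBot hreg.field_smooth.continuousOn
      (hV.tendsto_abs hreg.field_mem hv0) with h | h
    · exact ⟨_, Or.inl rfl, h⟩
    · exact ⟨_, Or.inr rfl, h⟩
  refine ⟨l, hl, hφl, fun α hα hα2 => ?_⟩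
  obtain ⟨hα0, hβ⟩ :=
    Quintessence.eventually_deriv_le_of_steepness hV hreg.field_mem hφl hα
  obtain ⟨h1, h2⟩ := Quintessence.sq_steepness_le hn hα0 hα2
  set y₀ := 1 / 2 * √(((n : ℝ) - 1) / n) * α
  -- The bound is proved for every y in (y₀, 1) and y then decreases to y₀; this leaves room for
  -- some β > α, which is needed because α is only a limit superior.
  have hlim : Tendsto (fun y : ℝ => (((1 - y)⁻¹ : ℝ) : EReal)) (𝓝[>] y₀)
      (𝓝 (((1 - y₀)⁻¹ : ℝ) : EReal)) := by
    refine (continuous_coe_real_ereal.tendsto _).comp (Tendsto.mono_left ?_ nhdsWithin_le_nhds)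
    exact (tendsto_const_nhds.sub tendsto_id).inv₀ (by simp; linarith)
  refine ge_of_tendsto hlim ?_
  filter_upwards [Ioo_mem_nhdsGT h2] with y hy
  obtain ⟨β, hβα, hβy⟩ : ∃ β > α, n * β ^ 2 / 16 < y := by
    have hc : Tendsto (fun β : ℝ => n * β ^ 2 / 16) (𝓝[>] α) (𝓝 (n * α ^ 2 / 16)) :=
      (Continuous.tendsto (by fun_prop) α).mono_left nhdsWithin_le_nhds
    exact ((eventually_mem_nhdsWithin (s := Ioi α)).and (hc.eventually (gt_mem_nhds (h1.trans_lt hy.1)))).exists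
  refine limsup_le_of_le (h := ?_)
  filter_upwards [sys.eventually_ratio_ge (hβ β hβα) hβy hy.2] with t ht
  exact EReal.coe_le_coe_iff.2 ht
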